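/- All strings are over $\{0,1\}$. A promise problem is a pair $\Pi=(\Pi_{YES},\Pi_{NO})$ of disjoint sets of strings. $\mathrm{prOMA}$ is the class of promise problems $\Pi$ for which there are polynomials $p,t$ and a polynomial-time deterministic Turing machine $A$ with Boolean output such that for every $n\in\mathbb N$ there is a witness $w_n\in\{0,1\}^{p(n)}$ satisfying, for every $x\in\{0,1\}^n$: if $x\in\Pi_{YES}$, then $A(x,r,w_n)=1$ for all $r\in\{0,1\}^{t(n)}$; if $x\in\Pi_{NO}$, then $\Pr_{r}[A(x,r,w)=1]<1/2$ for all $w\in\{0,1\}^{p(n)}$, where $r$ is uniform in $\{0,1\}^{t(n)}$. $\mathrm{O}_2^{\mathrm P}$ is the class of languages $L$ for which there are a polynomial $s$ and a polynomial-time deterministic Turing machine $A$ with Boolean output such that for every $n\in\mathbb N$ there are $w^{(0)}_n,w^{(1)}_n\in\{0,1\}^{s(n)}$ satisfying, for every $x\in\{0,1\}^n$: if $x\in L$, then $A(x,w^{(1)}_n,v)=1$ for all $v\in\{0,1\}^{s(n)}$; if $x\notin L$, then $A(x,u,w^{(0)}_n)=0$ for all $u\in\{0,1\}^{s(n)}$.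 For a promise problem $\Pi$, $\mathrm P^{\Pi}$ (loose oracle access) is the class of languages $L$ for which there is a deterministic oracle Turing machine $M^\bullet$, stopped in polynomial time whatever the oracle answers, such that $M^\bullet(x)=L(x)$ for every input $x$ and every behaviour of the oracle that answers "yes" to all queries in $\Pi_{YES}$ and "no" to all queries in $\Pi_{NO}$; answers to other queries are arbitrary and may even differ for repeated occurrences of the same query. Put $\mathrm P^{\mathrm{prOMA}}=\bigcup_{\Pi\in\mathrm{prOMA}}\mathrm P^{\Pi}$. Theorem. $\mathrm P^{\mathrm{prOMA}}\subseteq \mathrm O_2^{\mathrm P}$. -/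

import Mathlib

open Turing Computability

noncomputable section

/-! ### Promise problems -/

/-- A promise problem over the binary alphabet: a pair of disjoint sets of strings. -/
structure PromiseProblem where
  yes : Language Bool
  no : Language Bool
  disjoint : ∀ x, x ∈ yes → x ∉ no

/-- A language viewed as a promise problem without a proper promise: every string which is not a
"yes" instance is a "no" instance. -/
def PromiseProblem.ofLanguage (L : Language Bool) : PromiseProblem where
  yes := L
  no := {x | x ∉ L}
  disjoint := fun _ hx hx' => hx' hx

/-! ### Polynomial-time verifiers with three arguments -/

/-- The string written on the input stack for a triple of binary strings: `x # u # v`, where the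
separator `#` is `none`. -/
def encodeTriple (t : List Bool × List Bool × List Bool) : List (Option Bool) :=
  t.1.map some ++ none :: (t.2.1.map some ++ none :: t.2.2.map some)

/-- `A` is computed by a deterministic Turing machine that runs in time polynomial in the total
length of its three arguments and outputs one bit (the verdict). -/
def PolyTimeVerifier (A : List Bool → List Bool → List Bool → Bool) : Prop :=
  Nonempty (TM2ComputableInPolyTime encodeTriple encodeBool
    (fun t : List Bool × List Bool × List Bool => A t.1 t.2.1 t.2.2))

/-! ### The classes `prO₂ᴾ` and `O₂ᴾ` -/

/-- `prO₂ᴾ`: input-oblivious symmetric alternation. Certificates have polynomial length `s(n)`;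
for every input length `n` there are irrefutable certificates `w₁` and `w₀` which depend on `n`
only. Nothing is required outside the promise, except that `A` is a polynomial-time machine. -/
def PrO2P : Set PromiseProblem :=
  {P | ∃ (s : Polynomial ℕ) (A : List Bool → List Bool → List Bool → Bool),
    PolyTimeVerifier A ∧
    ∀ n : ℕ, ∃ w₀ w₁ : List Bool, w₀.length = s.eval n ∧ w₁.length = s.eval n ∧
      ∀ x : List Bool, x.length = n →
        (x ∈ P.yes → ∀ v : List Bool, v.length = s.eval n → A x w₁ v = true) ∧
        (x ∈ P.no → ∀ u : List Bool, u.length = s.eval n → A x u w₀ = false)}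

/-- `O₂ᴾ`: the languages which, viewed as promise problems, are in `prO₂ᴾ`. -/
def O2P : Set (Language Bool) :=
  {L | PromiseProblem.ofLanguage L ∈ PrO2P}

/-! ### The class `prOMA` -/

/-- The probability that a uniformly random binary string of length `t` satisfies `E`. -/
def uniformProb (t : ℕ) (E : List Bool → Prop) : ℚ :=
  (Nat.card {r : Fin t → Bool // E (List.ofFn r)} : ℚ) / 2 ^ t

/-- `prOMA`: input-oblivious Merlin–Arthur protocols with perfect completeness. Witnesses have
polynomial length `p(n)` and Arthur's random strings have polynomial length `t(n)`; for every input
length `n` one witness serves all the "yes" instances of length `n`. -/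
def PrOMA : Set PromiseProblem :=
  {P | ∃ (p t : Polynomial ℕ) (A : List Bool → List Bool → List Bool → Bool),
    PolyTimeVerifier A ∧
    ∀ n : ℕ, ∃ w₁ : List Bool, w₁.length = p.eval n ∧
      ∀ x : List Bool, x.length = n →
        (x ∈ P.yes → ∀ r : List Bool, r.length = t.eval n → A x r w₁ = true) ∧
        (x ∈ P.no → ∀ w : List Bool, w.length = p.eval n →
          uniformProb (t.eval n) (fun r => A x r w = true) < 1 / 2)}

/-! ### Oracle Turing machines and loose oracle access -/

/-- A deterministic oracle Turing machine with binary input and output: a (multi-stack) Turing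
machine with a query stack over the binary alphabet and three distinguished labels `query`,
`yesLabel`, `noLabel`.
The internal memory and the input alphabet are finite, hence only finitely many symbols of the
other stacks can ever occur. -/
structure OracleTM extends TM2ComputableAux Bool Bool where
  kq : tm.K
  queryAlphabet : tm.Γ kq ≃ Bool
  query : tm.Λ
  yesLabel : tm.Λ
  noLabel : tm.Λ

namespace OracleTM

variable (M : OracleTM)

/-- The configurations of the machine: current label (`none` if halted), internal memory, stacks. -/
abbrev Cfg : Type := TM2.Cfg M.tm.Γ M.tm.Λ M.tm.σ

/-- The string currently written on the query stack. -/
def queryWord (c : M.Cfg) : List Bool :=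
  (c.stk M.kq).map M.queryAlphabet

open Classical in
/-- One step of the machine when the oracle's present answers are given by `ans`. At the label
`query` the machine jumps to `yesLabel` or `noLabel` according to the oracle's answer to the word on
the query stack, and the query stack is erased; at any other label it makes an ordinary step.
The value is `none` if the machine has halted. -/
def step (ans : List Bool → Bool) (c : M.Cfg) : Option M.Cfg :=
  if c.l = some M.query then
    some
      { l := some (if ans (M.queryWord c) = true then M.yesLabel else M.noLabel)
        var := c.var
        stk := Function.update c.stk M.kq [] }
  else TM2.step M.tm.m c

/-- The initial configuration on input `x`. -/
def init (x : List Bool) : M.Cfg :=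
  initList M.tm (x.map M.inputAlphabet.symm)

/-- The halting configuration with output `b`. -/
def halted (b : Bool) : M.Cfg :=
  haltList M.tm ((encodeBool b).map M.outputAlphabet.symm)

/-- The configuration reached from `c` after `T` steps (a halted machine stays put) with a
black-box oracle `B`, where `B i` are the answers which the oracle gives at the `i`-th step. The
answers to the same query at different steps need not agree. -/
def run (B : ℕ → List Bool → Bool) (c : M.Cfg) : ℕ → M.Cfg
  | 0 => c
  | T + 1 => (M.step (B T) (run B c T)).getD (run B c T)

/-- With the black-box oracle `B`, on input `x`, the machine halts within `T` steps
with output `b`. -/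
def OutputsWithin (B : ℕ → List Bool → Bool) (x : List Bool) (b : Bool) (T : ℕ) : Prop :=
  M.run B (M.init x) T = M.halted b

end OracleTM

/-- The black box `B` answers correctly every query inside the promise of `P`. Outside the promise
its answers are arbitrary, and may be different for the same query asked at different times. -/
def LooselyAnswers (B : ℕ → List Bool → Bool) (P : PromiseProblem) : Prop :=
  ∀ (i : ℕ) (q : List Bool), (q ∈ P.yes → B i q = true) ∧ (q ∈ P.no → B i q = false)

/-- The class of languages decidable in polynomial time with the promise problem `P` as an oracle,
in the loose access mode: the languages `L`
decided by a deterministic oracle Turing machine which stops in polynomial time (whatever the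
oracle answers), and which produces the answer `L(x)` on every input `x` and with every black box
that is correct inside the promise of `P`. -/
def PWithOracle (P : PromiseProblem) : Set (Language Bool) :=
  {L | ∃ (M : OracleTM) (p : Polynomial ℕ),
    (∀ (x : List Bool) (B : ℕ → List Bool → Bool),
      ∃ b : Bool, M.OutputsWithin B x b (p.eval x.length)) ∧
    ∀ (x : List Bool) (B : ℕ → List Bool → Bool), LooselyAnswers B P →
      ∃ b : Bool, M.OutputsWithin B x b (p.eval x.length) ∧ (b = true ↔ x ∈ L)}

/-- Polynomial time with a class `C` of promise problems as an oracle: one promise problem of `C` is used as the oracle. -/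
def PWithOracleClass (C : Set PromiseProblem) : Set (Language Bool) :=
  {L | ∃ P ∈ C, L ∈ PWithOracle P}

end

noncomputable section

/-! Let `M` decide `L` with a promise problem in prOMA as oracle, let `A` be the Merlin–Arthur
verifier, with witness length p and randomness length t. On inputs of length n all queries have
length at most some Q, polynomial in n, because the stacks of `M` grow by a bounded amount per step
(`exists_length_run_le`).

Fix a query length m ≤ Q. There are at most 2^(m+p(m)) pairs of a no-instance and a witness, and
each pair is accepted by less than half of the random strings. By averaging, some random string
rejects more than half of any nonempty set of such pairs; iterating, at most m+p(m)+1 strings refute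
all of them (`exists_hitting_list`, `exists_refuting_list`). Let c be the concatenation, over all m
≤ Q, of the good witness for length m and these refuting strings (`exists_certificate`).

The symmetric verifier joins its two certificates into one string u ++ v and simulates `M`. It
answers a query q by "yes" iff some window of u ++ v of length p(|q|) is accepted by `A` together
with every window of length t(|q|) (`verdictOn`). If c occurs in u ++ v, these answers are right
inside the promise, whatever else the string contains (`verdictOn_correct`): by perfect completeness
the good witness survives every window, also those supplied by an adversary, and any witness
supplied for a no-instance meets a refuting string. Hence c is irrefutable on either side. Answers
outside the promise do not matter, by loose access.

The larger part of the proof shows that this verifier is a polynomial-time machine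
(`polyTimeVerifier_of_oracleTM`). Structured programs over stacks are compiled to machines with a
count of steps (`Exec.stepsTo`), and the windows, the polynomials p and t in unary, and the steps of
`M` and of the machine for `A` are handled by such programs. -/

/-! ### Structured programs over stacks -/

namespace StackProg

variable {K : Type} [DecidableEq K] {Γ : K → Type} {σ : Type}

/-- Replace the final jumps of a straight-line statement by the statement `fin`. -/
def andThen {Λ : Type} : TM2.Stmt Γ Unit σ → TM2.Stmt Γ Λ σ → TM2.Stmt Γ Λ σ
  | .push k f q, fin => .push k f (andThen q fin)
  | .peek k f q, fin => .peek k f (andThen q fin)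
  | .pop k f q, fin => .pop k f (andThen q fin)
  | .load f q, fin => .load f (andThen q fin)
  | .branch f q₁ q₂, fin => .branch f (andThen q₁ fin) (andThen q₂ fin)
  | .goto _, fin => fin
  | .halt, fin => fin

theorem stepAux_andThen {Λ : Type} (q : TM2.Stmt Γ Unit σ) (fin : TM2.Stmt Γ Λ σ) (v : σ)
    (S : ∀ k, List (Γ k)) :
    TM2.stepAux (andThen q fin) v S =
      TM2.stepAux fin (TM2.stepAux q v S).var (TM2.stepAux q v S).stk := by
  induction q generalizing v S with
  | branch f q₁ q₂ h₁ h₂ => cases h : f v <;> simp [andThen, h, h₁, h₂]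
  | _ => simp_all [andThen]

/-- Structured programs: a block chooses a straight-line statement according to the internal
memory, a loop executes `pre`, tests the memory, and as long as the test succeeds executes its
body. -/
inductive Prog (Γ : K → Type) (σ : Type) : Type
  | block (code : σ → TM2.Stmt Γ Unit σ)
  | seq (p q : Prog Γ σ)
  | loop (pre : TM2.Stmt Γ Unit σ) (cond : σ → Bool) (p : Prog Γ σ)
  | ite (cond : σ → Bool) (p q : Prog Γ σ)

/-- The effect of a straight-line statement. -/
def effect (q : TM2.Stmt Γ Unit σ) (s : σ × ∀ k, List (Γ k)) : σ × ∀ k, List (Γ k) :=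
  ((TM2.stepAux q s.1 s.2).var, (TM2.stepAux q s.1 s.2).stk)

/-- `Exec p s s' t`: the program `p` leads from the state `s` to the state `s'` in `t` steps. -/
inductive Exec : Prog Γ σ → (σ × ∀ k, List (Γ k)) → (σ × ∀ k, List (Γ k)) → ℕ → Prop
  | block (code s) : Exec (.block code) s (effect (code s.1) s) 2
  | seq {p q s₁ s₂ s₃ a b} : Exec p s₁ s₂ a → Exec q s₂ s₃ b → Exec (.seq p q) s₁ s₃ (a + b)
  | loop_done {pre cond p s} : cond (effect pre s).1 = false →
      Exec (.loop pre cond p) s (effect pre s) 1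
  | loop_step {pre cond p s s₂ s₃ a b} : cond (effect pre s).1 = true →
      Exec p (effect pre s) s₂ a → Exec (.loop pre cond p) s₂ s₃ b →
      Exec (.loop pre cond p) s s₃ (1 + a + b)
  | ite_true {cond p q s s₂ a} : cond s.1 = true → Exec p s s₂ a →
      Exec (.ite cond p q) s s₂ (1 + a)
  | ite_false {cond p q s s₂ a} : cond s.1 = false → Exec q s s₂ a →
      Exec (.ite cond p q) s s₂ (1 + a)

/-- The labels of the machine code of a program. -/
def Pos : Prog Γ σ → Type
  -- At `none` the machine reads its memory `v` and jumps to `some v`, where the statement chosen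
  -- for `v` is executed; hence a block costs two steps.
  | .block _ => Option σ
  | .seq p q => Pos p ⊕ Pos q
  | .loop _ _ p => Option (Pos p)
  | .ite _ p q => Option (Pos p ⊕ Pos q)

theorem finite_pos {K' : Type} {Γ' : K' → Type} {σ' : Type} [Finite σ'] (p : Prog Γ' σ') : Finite (Pos p) := by
  induction p with
  | block _ => exact inferInstanceAs (Finite (Option σ'))
  | seq p q hp hq => exact inferInstanceAs (Finite (Pos p ⊕ Pos q))
  | loop _ _ p hp => exact inferInstanceAs (Finite (Option (Pos p)))
  | ite _ p q hp hq => exact inferInstanceAs (Finite (Option (Pos p ⊕ Pos q)))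

/-- The label at which the machine code of a program begins. -/
def entry : (p : Prog Γ σ) → Pos p
  | .block _ => (none : Option σ)
  | .seq p _ => Sum.inl (entry p)
  | .loop _ _ p => (none : Option (Pos p))
  | .ite _ p q => (none : Option (Pos p ⊕ Pos q))

/-- Jump to a label, or halt. -/
def exitTo {Λ : Type} : Option Λ → TM2.Stmt Γ Λ σ
  | some l => .goto fun _ => l
  | none => .halt

@[simp] theorem stepAux_exitTo {Λ : Type} (e : Option Λ) (v : σ) (S : ∀ k, List (Γ k)) :
    TM2.stepAux (exitTo e) v S = ⟨e, v, S⟩ := by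
  cases e <;> rfl

/-- The machine code of a program within a machine with labels `Λ`, with exit `e`. -/
def code {Λ : Type} : (p : Prog Γ σ) → (e : Option Λ) → (Pos p → Λ) → Pos p → TM2.Stmt Γ Λ σ
  | .block c, e, emb, l => match (l : Option σ) with
    | none => .goto fun v => emb (some v : Option σ)
    | some v => andThen (c v) (exitTo e)
  | .seq p q, e, emb, l => match (l : Pos p ⊕ Pos q) with
    | .inl l => code p (some (emb (Sum.inr (entry q) : Pos p ⊕ Pos q)))
        (fun l => emb (Sum.inl l : Pos p ⊕ Pos q)) l
    | .inr l => code q e (fun l => emb (Sum.inr l : Pos p ⊕ Pos q)) l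
  | .loop pre cond p, e, emb, l => match (l : Option (Pos p)) with
    | none => andThen pre (.branch cond (.goto fun _ => emb (some (entry p) : Option (Pos p)))
        (exitTo e))
    | some l => code p (some (emb (none : Option (Pos p))))
        (fun l => emb (some l : Option (Pos p))) l
  | .ite cond p q, e, emb, l => match (l : Option (Pos p ⊕ Pos q)) with
    | none => .branch cond (.goto fun _ => emb (some (.inl (entry p)) : Option (Pos p ⊕ Pos q)))
        (.goto fun _ => emb (some (.inr (entry q)) : Option (Pos p ⊕ Pos q)))
    | some (.inl l) => code p e (fun l => emb (some (.inl l) : Option (Pos p ⊕ Pos q))) l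
    | some (.inr l) => code q e (fun l => emb (some (.inr l) : Option (Pos p ⊕ Pos q))) l

/-- A machine leads from one configuration to another in exactly `t` steps. -/
def StepsTo {Λ : Type} (m : Λ → TM2.Stmt Γ Λ σ) (c c' : TM2.Cfg Γ Λ σ) (t : ℕ) : Prop :=
  (flip bind (TM2.step m))^[t] (some c) = some c'

theorem StepsTo.trans {Λ : Type} {m : Λ → TM2.Stmt Γ Λ σ} {c₁ c₂ c₃ : TM2.Cfg Γ Λ σ} {a b : ℕ}
    (h₁ : StepsTo m c₁ c₂ a) (h₂ : StepsTo m c₂ c₃ b) : StepsTo m c₁ c₃ (a + b) := by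
  unfold StepsTo at *
  rw [add_comm, Function.iterate_add_apply, h₁, h₂]

theorem StepsTo.of_eq {Λ : Type} {m : Λ → TM2.Stmt Γ Λ σ} {l : Λ} {q : TM2.Stmt Γ Λ σ}
    (h : m l = q) (v : σ) (S : ∀ k, List (Γ k)) :
    StepsTo m ⟨some l, v, S⟩ (TM2.stepAux q v S) 1 := by
  subst h
  rfl

/-- The whole machine `m` stays fixed, while the exit and the embedding of labels vary in the
induction: a subprogram leaves to the entry of its successor or back to the head of the enclosing
loop. -/
theorem Exec.stepsTo {Λ : Type} {m : Λ → TM2.Stmt Γ Λ σ} {p : Prog Γ σ}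
    {s s' : σ × ∀ k, List (Γ k)} {t : ℕ} (h : Exec p s s' t) (e : Option Λ) (emb : Pos p → Λ)
    (hm : ∀ l, m (emb l) = code p e emb l) :
    StepsTo m ⟨some (emb (entry p)), s.1, s.2⟩ ⟨e, s'.1, s'.2⟩ t := by
  induction h generalizing e with
  | block c s =>
    refine (StepsTo.of_eq (hm (none : Option σ)) s.1 s.2).trans (b := 1) ?_
    have := StepsTo.of_eq (hm (some s.1 : Option σ)) s.1 s.2
    simp only [code, stepAux_andThen, stepAux_exitTo] at this
    exact this
  | @seq p q s₁ s₂ s₃ a b _ _ h₁ h₂ =>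
    exact (h₁ (some (emb (Sum.inr (entry q) : Pos p ⊕ Pos q)))
      (fun l => emb (Sum.inl l : Pos p ⊕ Pos q)) (fun l => hm (Sum.inl l : Pos p ⊕ Pos q))).trans
      (h₂ e (fun l => emb (Sum.inr l : Pos p ⊕ Pos q)) (fun l => hm (Sum.inr l : Pos p ⊕ Pos q)))
  | @loop_done pre cond p s hc =>
    have := StepsTo.of_eq (hm (none : Option (Pos p))) s.1 s.2
    simp only [effect] at hc
    simp only [code, stepAux_andThen, stepAux_exitTo, TM2.stepAux, hc, cond_false] at this
    exact this
  | @loop_step pre cond p s s₂ s₃ a b hc _ _ h₁ h₂ =>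
    have := StepsTo.of_eq (hm (none : Option (Pos p))) s.1 s.2
    simp only [effect] at hc
    simp only [code, stepAux_andThen, TM2.stepAux, hc, cond_true] at this
    exact (this.trans (h₁ (some (emb (none : Option (Pos p))))
      (fun l => emb (some l : Option (Pos p))) (fun l => hm (some l : Option (Pos p))))).trans
      (h₂ e emb hm)
  | @ite_true cond p q s s₂ a hc _ h =>
    have := StepsTo.of_eq (hm (none : Option (Pos p ⊕ Pos q))) s.1 s.2
    simp only [code, TM2.stepAux, hc, cond_true] at this
    exact this.trans (h e (fun l => emb (some (.inl l) : Option (Pos p ⊕ Pos q)))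
      (fun l => hm (some (.inl l) : Option (Pos p ⊕ Pos q))))
  | @ite_false cond p q s s₂ a hc _ h =>
    have := StepsTo.of_eq (hm (none : Option (Pos p ⊕ Pos q))) s.1 s.2
    simp only [code, TM2.stepAux, hc, cond_false] at this
    exact this.trans (h e (fun l => emb (some (.inr l) : Option (Pos p ⊕ Pos q)))
      (fun l => hm (some (.inr l) : Option (Pos p ⊕ Pos q))))

theorem Exec.stepsTo_halt {p : Prog Γ σ} {s s' : σ × ∀ k, List (Γ k)} {t : ℕ}
    (h : Exec p s s' t) :
    StepsTo (code p none id) ⟨some (entry p), s.1, s.2⟩ ⟨none, s'.1, s'.2⟩ t :=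
  h.stepsTo none id fun _ => rfl

/-- The program `p` leads from the state `s` to the state `s'` in at most `t` steps. -/
def Runs (p : Prog Γ σ) (s s' : σ × ∀ k, List (Γ k)) (t : ℕ) : Prop :=
  ∃ t' ≤ t, Exec p s s' t'

theorem Runs.mono {p : Prog Γ σ} {s s' : σ × ∀ k, List (Γ k)} {t u : ℕ} (h : Runs p s s' t)
    (htu : t ≤ u) : Runs p s s' u :=
  h.imp fun _ h => ⟨h.1.trans htu, h.2⟩

theorem Runs.of_eq {p : Prog Γ σ} {s s' s'' : σ × ∀ k, List (Γ k)} {t : ℕ} (h : Runs p s s' t)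
    (hs : s' = s'') : Runs p s s'' t :=
  hs ▸ h

theorem Runs.block {c : σ → TM2.Stmt Γ Unit σ} {s s' : σ × ∀ k, List (Γ k)}
    (h : effect (c s.1) s = s') : Runs (.block c) s s' 2 :=
  ⟨2, le_rfl, h ▸ Exec.block c s⟩

theorem Runs.seq {p q : Prog Γ σ} {s₁ s₂ s₃ : σ × ∀ k, List (Γ k)} {a b : ℕ} (h₁ : Runs p s₁ s₂ a)
    (h₂ : Runs q s₂ s₃ b) : Runs (.seq p q) s₁ s₃ (a + b) :=
  let ⟨x, hx, ex⟩ := h₁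
  let ⟨y, hy, ey⟩ := h₂
  ⟨x + y, add_le_add hx hy, ex.seq ey⟩

theorem Runs.loop_done {pre : TM2.Stmt Γ Unit σ} {cond : σ → Bool} {p : Prog Γ σ}
    {s s' : σ × ∀ k, List (Γ k)} (h : effect pre s = s') (hc : cond s'.1 = false) :
    Runs (.loop pre cond p) s s' 1 := by
  subst h
  exact ⟨1, le_rfl, Exec.loop_done hc⟩

theorem Runs.loop_step {pre : TM2.Stmt Γ Unit σ} {cond : σ → Bool} {p : Prog Γ σ}
    {s s₁ s₂ s₃ : σ × ∀ k, List (Γ k)} {a b : ℕ} (h : effect pre s = s₁) (hc : cond s₁.1 = true)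
    (h₁ : Runs p s₁ s₂ a) (h₂ : Runs (.loop pre cond p) s₂ s₃ b) :
    Runs (.loop pre cond p) s s₃ (1 + a + b) := by
  subst h
  obtain ⟨x, hx, ex⟩ := h₁
  obtain ⟨y, hy, ey⟩ := h₂
  exact ⟨1 + x + y, by omega, Exec.loop_step hc ex ey⟩

theorem Runs.ite_true {cond : σ → Bool} {p q : Prog Γ σ} {s s' : σ × ∀ k, List (Γ k)} {a : ℕ}
    (hc : cond s.1 = true) (h : Runs p s s' a) : Runs (.ite cond p q) s s' (1 + a) := by
  obtain ⟨x, hx, ex⟩ := h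
  exact ⟨1 + x, by omega, Exec.ite_true hc ex⟩

theorem Runs.ite_false {cond : σ → Bool} {p q : Prog Γ σ} {s s' : σ × ∀ k, List (Γ k)} {a : ℕ}
    (hc : cond s.1 = false) (h : Runs q s s' a) : Runs (.ite cond p q) s s' (1 + a) := by
  obtain ⟨x, hx, ex⟩ := h
  exact ⟨1 + x, by omega, Exec.ite_false hc ex⟩

end StackProg

/-! ### The simulating machine -/

namespace Simulation

open StackProg

variable (M : OracleTM) (V : TM2ComputableAux (Option Bool) Bool)

/-- The work stacks of the simulating machine: the input, a scratch stack, two copies of the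
certificates with the stacks holding their scanned parts, the query, two unary lengths and a
counter. -/
inductive Own
  | inp | tmp | c₁ | d₁ | c₂ | d₂ | qry | len₁ | len₂ | cnt
  deriving DecidableEq

instance : Fintype Own where
  elems := {.inp, .tmp, .c₁, .d₁, .c₂, .d₂, .qry, .len₁, .len₂, .cnt}
  complete k := by cases k <;> simp

/-- The internal memory of the simulating machine. -/
structure Var where
  reg : Option (Option Bool)
  ok : Bool
  found : Bool
  mlab : Option M.tm.Λ
  mvar : M.tm.σ
  vlab : Option V.tm.Λ
  vvar : V.tm.σ

instance : Finite (Var M V) := by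
  have := M.tm.ΛFin
  have := M.tm.σFin
  have := V.tm.ΛFin
  have := V.tm.σFin
  refine Finite.of_injective (fun v : Var M V =>
    (v.reg, v.ok, v.found, v.mlab, v.mvar, v.vlab, v.vvar)) ?_
  rintro ⟨⟩ ⟨⟩ h
  simpa using h

/-- The stacks of the simulating machine. -/
abbrev Idx : Type := M.tm.K ⊕ V.tm.K ⊕ Own

/-- The stack alphabets of the simulating machine. -/
abbrev Sym : Idx M V → Type
  | .inl k => M.tm.Γ k
  | .inr (.inl k) => V.tm.Γ k
  | .inr (.inr _) => Option Bool

variable {M V}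

/-- The contents of all stacks. -/
def join (m : ∀ k, List (M.tm.Γ k)) (w : ∀ k, List (V.tm.Γ k)) (o : Own → List (Option Bool)) :
    ∀ k, List (Sym M V k)
  | .inl k => m k
  | .inr (.inl k) => w k
  | .inr (.inr k) => o k

section join

variable (m : ∀ k, List (M.tm.Γ k)) (w : ∀ k, List (V.tm.Γ k)) (o : Own → List (Option Bool))

@[simp] theorem join_inl (k : M.tm.K) : join m w o (.inl k) = m k := rfl

@[simp] theorem join_inr_inl (k : V.tm.K) : join m w o (.inr (.inl k)) = w k := rfl

@[simp] theorem join_inr_inr (k : Own) : join m w o (.inr (.inr k)) = o k := rfl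

@[simp] theorem update_join_inl (k : M.tm.K) (l : List (M.tm.Γ k)) :
    Function.update (join m w o) (.inl k : Idx M V) l = join (Function.update m k l) w o := by
  funext j
  rcases j with j | j | j
  · by_cases h : j = k
    · subst h
      simp
    · simp [h]
  · simp
  · simp

@[simp] theorem update_join_inr_inl (k : V.tm.K) (l : List (V.tm.Γ k)) :
    Function.update (join m w o) (.inr (.inl k) : Idx M V) l =
      join m (Function.update w k l) o := by
  funext j
  rcases j with j | j | j
  · simp
  · by_cases h : j = k
    · subst h
      simp
    · simp [h]
  · simp

@[simp] theorem update_join_inr_inr (k : Own) (l : List (Option Bool)) :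
    Function.update (join m w o) (.inr (.inr k) : Idx M V) l =
      join m w (Function.update o k l) := by
  funext j
  rcases j with j | j | j
  · simp
  · simp
  · by_cases h : j = k
    · subst h
      simp
    · simp [h]

end join

/-- The state of the simulating machine. -/
def state (reg : Option (Option Bool)) (ok found : Bool) (mc : M.Cfg)
    (vc : TM2.Cfg V.tm.Γ V.tm.Λ V.tm.σ) (o : Own → List (Option Bool)) :
    Var M V × ∀ k, List (Sym M V k) :=
  (⟨reg, ok, found, mc.l, mc.var, vc.l, vc.var⟩, join mc.stk vc.stk o)

variable (M V) in
/-- Straight-line statements of the simulating machine. -/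
abbrev SStmt : Type := TM2.Stmt (Sym M V) Unit (Var M V)

variable (M V) in
/-- Programs of the simulating machine. -/
abbrev SProg : Type := Prog (Sym M V) (Var M V)

/-! #### Steps of the simulated machines -/

/-- A statement of the oracle machine, executed by the simulating machine. -/
def liftM : TM2.Stmt M.tm.Γ M.tm.Λ M.tm.σ → SStmt M V
  | .push k f q => .push (.inl k : Idx M V) (fun v => f v.mvar) (liftM q)
  | .peek k f q => .peek (.inl k : Idx M V) (fun v x => { v with mvar := f v.mvar x }) (liftM q)
  | .pop k f q => .pop (.inl k : Idx M V) (fun v x => { v with mvar := f v.mvar x }) (liftM q)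
  | .load f q => .load (fun v => { v with mvar := f v.mvar }) (liftM q)
  | .branch f q₁ q₂ => .branch (fun v => f v.mvar) (liftM q₁) (liftM q₂)
  | .goto f => .load (fun v => { v with mlab := some (f v.mvar) }) .halt
  | .halt => .load (fun v => { v with mlab := none }) .halt

/-- A statement of the verifier, executed by the simulating machine. -/
def liftV : TM2.Stmt V.tm.Γ V.tm.Λ V.tm.σ → SStmt M V
  | .push k f q => .push (.inr (.inl k) : Idx M V) (fun v => f v.vvar) (liftV q)
  | .peek k f q =>
    .peek (.inr (.inl k) : Idx M V) (fun v x => { v with vvar := f v.vvar x }) (liftV q)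
  | .pop k f q =>
    .pop (.inr (.inl k) : Idx M V) (fun v x => { v with vvar := f v.vvar x }) (liftV q)
  | .load f q => .load (fun v => { v with vvar := f v.vvar }) (liftV q)
  | .branch f q₁ q₂ => .branch (fun v => f v.vvar) (liftV q₁) (liftV q₂)
  | .goto f => .load (fun v => { v with vlab := some (f v.vvar) }) .halt
  | .halt => .load (fun v => { v with vlab := none }) .halt

variable (reg : Option (Option Bool)) (ok found : Bool) (mc : M.Cfg)
  (vc : TM2.Cfg V.tm.Γ V.tm.Λ V.tm.σ) (o : Own → List (Option Bool))

/-- Since `liftM` records the final jump in `mlab` instead of performing it, one straight-line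
statement carries out one full step of the simulated machine. -/
theorem effect_liftM (q : TM2.Stmt M.tm.Γ M.tm.Λ M.tm.σ) :
    effect (liftM q) (state reg ok found mc vc o) =
      state reg ok found (TM2.stepAux q mc.var mc.stk) vc o := by
  obtain ⟨l, v, S⟩ := mc
  induction q generalizing l v S with
  | push k f q ih => simpa [effect, liftM, state] using ih l v (Function.update S k (f v :: S k))
  | peek k f q ih => simpa [effect, liftM, state] using ih l (f v (S k).head?) S
  | pop k f q ih =>
    simpa [effect, liftM, state] using ih l (f v (S k).head?) (Function.update S k (S k).tail)
  | load f q ih => simpa [effect, liftM, state] using ih l (f v) S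
  | branch f q₁ q₂ h₁ h₂ =>
    cases h : f v
    · simpa [effect, liftM, state, h] using h₂ l v S
    · simpa [effect, liftM, state, h] using h₁ l v S
  | goto f => simp [effect, liftM, state]
  | halt => simp [effect, liftM, state]

theorem effect_liftV (q : TM2.Stmt V.tm.Γ V.tm.Λ V.tm.σ) :
    effect (liftV q) (state reg ok found mc vc o) =
      state reg ok found mc (TM2.stepAux q vc.var vc.stk) o := by
  obtain ⟨l, v, S⟩ := vc
  induction q generalizing l v S with
  | push k f q ih => simpa [effect, liftV, state] using ih l v (Function.update S k (f v :: S k))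
  | peek k f q ih => simpa [effect, liftV, state] using ih l (f v (S k).head?) S
  | pop k f q ih =>
    simpa [effect, liftV, state] using ih l (f v (S k).head?) (Function.update S k (S k).tail)
  | load f q ih => simpa [effect, liftV, state] using ih l (f v) S
  | branch f q₁ q₂ h₁ h₂ =>
    cases h : f v
    · simpa [effect, liftV, state, h] using h₂ l v S
    · simpa [effect, liftV, state, h] using h₁ l v S
  | goto f => simp [effect, liftV, state]
  | halt => simp [effect, liftV, state]

/-- One step of the oracle machine at a label which is not a query. -/
def stepM : SProg M V :=
  .block fun v => match v.mlab with
    | some l => liftM (M.tm.m l)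
    | none => .halt

/-- Run the verifier until it halts. -/
def runV : SProg M V :=
  .loop .halt (fun v => v.vlab.isSome) <| .block fun v => match v.vlab with
    | some l => liftV (V.tm.m l)
    | none => .halt

theorem runs_stepM {l : M.tm.Λ} (h : mc.l = some l) :
    Runs stepM (state reg ok found mc vc o)
      (state reg ok found (TM2.stepAux (M.tm.m l) mc.var mc.stk) vc o) 2 := by
  refine Runs.block ?_
  simp only [state, h]
  have := effect_liftM reg ok found mc vc o (M.tm.m l)
  simpa only [state, h] using this

theorem flip_bind_iterate_none {α : Type*} (f : α → Option α) (t : ℕ) :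
    (flip bind f)^[t] none = none := by
  induction t with
  | zero => rfl
  | succ t ih => rw [Function.iterate_succ_apply]; exact ih

theorem runs_runV (t : ℕ) {vc' : TM2.Cfg V.tm.Γ V.tm.Λ V.tm.σ}
    (h : (flip bind (TM2.step V.tm.m))^[t] (some vc) = some vc') (hl : vc'.l = none) :
    Runs runV (state reg ok found mc vc o) (state reg ok found mc vc' o) (3 * t + 1) := by
  induction t generalizing vc with
  | zero =>
    obtain rfl : vc = vc' := by simpa using h
    exact Runs.loop_done rfl (by simp [state, hl])
  | succ t ih =>
    obtain ⟨l, v, S⟩ := vc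
    cases l with
    | none =>
      -- A halted configuration has no successor, so the iterate would be `none` and not `some vc'`.
      rw [Function.iterate_succ_apply] at h
      have : (flip bind (TM2.step V.tm.m))^[t] none = some vc' := h
      rw [flip_bind_iterate_none] at this
      cases this
    | some l =>
      rw [Function.iterate_succ_apply] at h
      refine (Runs.loop_step (a := 2) (b := 3 * t + 1) rfl rfl (Runs.block ?_)
        (ih (TM2.stepAux (V.tm.m l) v S) h)).mono (by omega)
      exact effect_liftV reg ok found mc ⟨some l, v, S⟩ o (V.tm.m l)

/-! #### Moving strings between stacks -/

/-- The register as a stack symbol. -/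
def Var.sym (v : Var M V) : Option Bool := v.reg.getD none

/-- Pop a work stack into the register. -/
def popReg (a : Own) (q : SStmt M V) : SStmt M V :=
  .pop (.inr (.inr a) : Idx M V) (fun v x => { v with reg := x }) q

/-- Push the register on work stacks. -/
def pushes : List Own → SStmt M V
  | [] => .halt
  | b :: bs => .push (.inr (.inr b) : Idx M V) Var.sym (pushes bs)

/-- Pop the stack `a` until it is empty, pushing the symbols on each of the stacks `bs`. -/
def drain (a : Own) (bs : List Own) : SProg M V :=
  .loop (popReg a .halt) (fun v => v.reg.isSome) (.block fun _ => pushes bs)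

theorem effect_popReg (a : Own) :
    effect (popReg a .halt) (state reg ok found mc vc o) =
      state (o a).head? ok found mc vc (Function.update o a (o a).tail) := by
  simp [effect, popReg, state]

theorem effect_pushes (bs : List Own) (hbs : bs.Nodup) (x : Option Bool) :
    effect (pushes bs) (state (some x) ok found mc vc o) =
      state (some x) ok found mc vc (fun k => if k ∈ bs then x :: o k else o k) := by
  induction bs generalizing o with
  | nil => simp [effect, pushes, state]
  | cons b bs ih =>
    rw [List.nodup_cons] at hbs
    have := ih (Function.update o b (x :: o b)) hbs.2
    simp only [effect, pushes, state, TM2.stepAux, join_inr_inr, update_join_inr_inr, Var.sym,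
      Option.getD_some] at this ⊢
    rw [this]
    congr 2
    funext k
    by_cases hk : k = b
    · subst hk
      simp [hbs.1]
    · simp [hk]

/-- The work stacks after `drain a bs`. -/
def pour (a : Own) (bs : List Own) (o : Own → List (Option Bool)) : Own → List (Option Bool) :=
  fun k => if k = a then [] else if k ∈ bs then (o a).reverse ++ o k else o k

/-- Each symbol costs one test and one block, that is three steps, and the failing test at the end
costs one. The same count recurs in the other loops over a stack. -/
theorem runs_drain (a : Own) (bs : List Own) (hbs : bs.Nodup) (ha : a ∉ bs) :
    Runs (drain a bs) (state reg ok found mc vc o) (state none ok found mc vc (pour a bs o))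
      (3 * (o a).length + 1) := by
  generalize hl : o a = l
  induction l generalizing o reg with
  | nil =>
    refine Runs.loop_done ?_ rfl
    rw [effect_popReg, hl]
    congr 1
    funext k
    by_cases hk : k = a
    · subst hk
      simp [pour]
    · simp [hk, pour, hl]
  | cons x l ih =>
    refine (Runs.loop_step (a := 2) (b := 3 * l.length + 1) (effect_popReg _ _ _ _ _ _ _) ?_
      (Runs.block (s' := state (some x) ok found mc vc
        (fun k => if k = a then l else if k ∈ bs then x :: o k else o k)) ?_) ?_).mono
      (by simp; omega)
    · simp [hl, state]
    · rw [hl, List.head?_cons, effect_pushes _ _ _ _ _ _ hbs]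
      congr 1
      funext k
      by_cases hk : k = a
      · subst hk
        simp [ha]
      · simp [hk]
    · have := ih (some x) (fun k => if k = a then l else if k ∈ bs then x :: o k else o k) (by simp)
      have hp : pour a bs (fun k => if k = a then l else if k ∈ bs then x :: o k else o k) =
          pour a bs o := ?_
      · rwa [hp] at this
      funext k
      by_cases hk : k = a
      · subst hk
        simp [pour]
      · by_cases hb : k ∈ bs <;> simp [pour, hk, hb, hl]

/-! #### Running the verifier on windows of the certificates -/

theorem update_initList_stk (tm : FinTM2) (l l' : List (tm.Γ tm.k₀)) :
    Function.update (initList tm l).stk tm.k₀ l' = (initList tm l').stk := by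
  funext k
  by_cases hk : k = tm.k₀
  · subst hk
    simp [initList]
  · simp [initList, hk]

theorem initList_stk_self (tm : FinTM2) (l : List (tm.Γ tm.k₀)) :
    (initList tm l).stk tm.k₀ = l := by
  simp [initList]

theorem initList_nil_stk (tm : FinTM2) (k : tm.K) : (initList tm []).stk k = [] := by
  by_cases hk : k = tm.k₀
  · subst hk
    simp [initList]
  · simp [initList, hk]

/-- A halting configuration has the initial memory and nothing outside the output stack. Once the
verdict is popped, the verifier can therefore be run again without any cleaning. -/
theorem update_haltList_stk (tm : FinTM2) (l : List (tm.Γ tm.k₁)) :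
    Function.update (haltList tm l).stk tm.k₁ [] = (initList tm []).stk := by
  funext k
  rw [initList_nil_stk]
  by_cases hk : k = tm.k₁
  · subst hk
    simp
  · simp [haltList, hk]

theorem haltList_stk_self (tm : FinTM2) (l : List (tm.Γ tm.k₁)) :
    (haltList tm l).stk tm.k₁ = l := by
  simp [haltList]

variable (V) in
/-- The verifier, ready to run on the input `w`. -/
def loaded (w : List (Option Bool)) : TM2.Cfg V.tm.Γ V.tm.Λ V.tm.σ :=
  initList V.tm (w.map V.inputAlphabet.symm)

/-- Push a symbol on the input stack of the verifier. -/
def pushV (x : Option Bool) (q : SStmt M V) : SStmt M V :=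
  .push (.inr (.inl V.tm.k₀) : Idx M V) (fun _ => V.inputAlphabet.symm x) q

theorem effect_pushV (x : Option Bool) (w : List (Option Bool)) :
    effect (pushV x .halt) (state reg ok found mc (loaded V w) o) =
      state reg ok found mc (loaded V (x :: w)) o := by
  simp only [effect, pushV, state, TM2.stepAux, loaded, join_inr_inl, initList_stk_self,
    update_join_inr_inl, update_initList_stk, List.map_cons]
  rfl

theorem runs_pushV (x : Option Bool) (w : List (Option Bool)) :
    Runs (.block fun _ => pushV x .halt) (state reg ok found mc (loaded V w) o)
      (state reg ok found mc (loaded V (x :: w)) o) 2 :=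
  Runs.block (effect_pushV _ _ _ _ _ _ _)

/-- Move the scratch stack to the stack `a` and to the input stack of the verifier; blanks are
not moved to `a`, and they are replaced by `false` for the verifier. -/
def restore (a : Own) : SProg M V :=
  .loop (popReg .tmp .halt) (fun v => v.reg.isSome) <| .block fun v => match v.sym with
    | some b => .push (.inr (.inr a) : Idx M V) (fun _ => some b) (pushV (some b) .halt)
    | none => pushV (some false) .halt

/-- Blanks on the scratch stack are padding from `takeUnits`: the verifier must see zeros there,
whereas the stack `a` must regain its original contents. -/
theorem runs_restore (a : Own) (ha : a ≠ .tmp) (w : List (Option Bool)) :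
    Runs (restore a) (state reg ok found mc (loaded V w) o)
      (state none ok found mc
        (loaded V ((o .tmp).reverse.map (fun x => some (x.getD false)) ++ w))
        (Function.update (Function.update o .tmp []) a
          (((o .tmp).filter Option.isSome).reverse ++ o a)))
      (3 * (o .tmp).length + 1) := by
  generalize hl : o .tmp = l
  induction l generalizing o reg w with
  | nil =>
    refine Runs.loop_done ?_ rfl
    rw [effect_popReg, hl]
    congr 1
    simp [Function.update_of_ne ha]
  | cons x l ih =>
    have hb : Runs (.block fun v : Var M V => match v.sym with
        | some b => .push (.inr (.inr a) : Idx M V) (fun _ => some b) (pushV (some b) .halt)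
        | none => pushV (some false) .halt)
        (state (some x) ok found mc (loaded V w) (Function.update o .tmp l))
        (state (some x) ok found mc (loaded V (some (x.getD false) :: w))
          (Function.update (Function.update o .tmp l) a ([x].filter Option.isSome ++ o a))) 2 := by
      refine Runs.block ?_
      cases x with
      | none =>
        have := effect_pushV (V := V) (some none) ok found mc (Function.update o .tmp l) (some false) w
        have h : Function.update (Function.update o .tmp l) a (o a) = Function.update o .tmp l := by
          rw [Function.update_eq_self_iff, Function.update_of_ne ha]
        simpa [state, Var.sym, h] using this
      | some b =>
        have := effect_pushV (V := V) (some (some b)) ok found mc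
          (Function.update (Function.update o .tmp l) a (some b :: o a)) (some b) w
        simpa [state, Var.sym, Function.update_of_ne ha, effect] using this
    refine (Runs.loop_step (b := 3 * l.length + 1)
      (effect_popReg reg ok found mc (loaded V w) o .tmp) (by simp [hl, state])
      (by simpa [hl] using hb) ?_).mono (by simp; omega)
    have := ih (some x)
      (Function.update (Function.update o .tmp l) a ([x].filter Option.isSome ++ o a))
      (some (x.getD false) :: w) (by simp [Function.update_of_ne ha.symm])
    refine this.of_eq ?_
    congr 1
    · simp
    · funext k
      by_cases hk : k = a
      · subst hk
        cases x <;> simp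
      · by_cases hk' : k = .tmp
        · subst hk'
          simp [hk]
        · simp [hk, hk']

/-- The first `k` bits of a string, padded with zeros if the string is too short. -/
def win (k : ℕ) (z : List Bool) : List Bool :=
  z.take k ++ List.replicate (k - z.length) false

@[simp] theorem length_win (k : ℕ) (z : List Bool) : (win k z).length = k := by
  simp [win]
  omega

/-- Pop a symbol from `a` for each unit popped from `b`, and move it to the scratch stack. -/
def takeUnits (a b : Own) : SProg M V :=
  .loop (popReg b .halt) (fun v => v.reg.isSome) <| .block fun _ =>
    .push (.inr (.inr .cnt) : Idx M V) (fun _ => none) (popReg a (pushes [.tmp]))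

/-- Popping an empty stack leaves `none` in the register, which is pushed as a blank, so a stack
that is too short is padded without a separate case. The units are kept on `cnt`, from where the
unary length on `b` is rebuilt. -/
theorem runs_takeUnits (a b : Own) (hab : a ≠ b) (ha : a ≠ .tmp) (ha' : a ≠ .cnt) (hb : b ≠ .tmp)
    (hb' : b ≠ .cnt) (k : ℕ) (ho : o b = List.replicate k none) :
    Runs (takeUnits a b) (state reg ok found mc vc o)
      (state none ok found mc vc (Function.update (Function.update (Function.update
        (Function.update o b []) .cnt (List.replicate k none ++ o .cnt)) a ((o a).drop k))
        .tmp (((o a).take k ++ List.replicate (k - (o a).length) none).reverse ++ o .tmp)))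
      (3 * k + 1) := by
  induction k generalizing o reg with
  | zero =>
    refine Runs.loop_done ?_ rfl
    rw [effect_popReg, ho]
    congr 1
    funext j
    by_cases h₁ : j = .tmp
    · subst h₁
      simp [Function.update_of_ne hb.symm]
    by_cases h₂ : j = a
    · subst h₂
      simp [h₁, hab]
    by_cases h₃ : j = .cnt
    · subst h₃
      simp [h₂, Function.update_of_ne hb'.symm]
    simp [h₁, h₂, h₃]
  | succ k ih =>
    let o' := Function.update (Function.update (Function.update (Function.update o b
      (List.replicate k none)) .cnt (none :: o .cnt)) a (o a).tail) .tmp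
      ((o a).head?.getD none :: o .tmp)
    refine (Runs.loop_step (b := 3 * k + 1) (s₂ := state (o a).head? ok found mc vc o')
      (effect_popReg reg ok found mc vc o b)
      (by simp [ho, state, List.replicate_succ]) (Runs.block ?_) ?_).mono
      (show 1 + 2 + (3 * k + 1) ≤ 3 * (k + 1) + 1 by omega)
    · simp [effect, state, popReg, pushes, Var.sym, ho, o', List.replicate_succ, ha', hab, ha.symm,
        hb.symm, Function.update_of_ne hb'.symm]
    · have := ih (o a).head? o' (by simp [o', hb, hb', hab.symm])
      refine this.of_eq ?_
      congr 1
      funext j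
      by_cases h₁ : j = .tmp
      · subst h₁
        cases h : o a
        · simp only [o', h, ha, Function.update_self, Function.update_of_ne, ne_eq,
            not_false_eq_true]
          simp
          rw [List.append_cons, ← List.replicate_succ']
        · simp [o', ha, h]
      by_cases h₂ : j = a
      · subst h₂
        simp [h₁, o']
      by_cases h₃ : j = .cnt
      · subst h₃
        simp [h₂, o', List.replicate_succ']
      by_cases h₄ : j = b
      · subst h₄
        simp [h₁, h₂, h₃]
      simp [h₁, h₂, h₃, h₄, o']

theorem filter_isSome_map_some (z : List Bool) :
    (z.map some).filter Option.isSome = z.map some := by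
  induction z <;> simp_all

/-- Push a window of the stack `a`, whose length in unary is on `b`, on the input stack of the
verifier. -/
def loadWin (a b : Own) : SProg M V :=
  .seq (takeUnits a b) (.seq (drain .cnt [b]) (restore a))

/-- Three passes over the window, of `3 * k + 1` steps each. The work stacks end as they began, so
the window can be read again. -/
theorem runs_loadWin (a b : Own) (hab : a ≠ b) (ha : a ≠ .tmp) (ha' : a ≠ .cnt) (hb : b ≠ .tmp)
    (hb' : b ≠ .cnt) (k : ℕ) (z : List Bool) (w : List (Option Bool)) (htmp : o .tmp = [])
    (hcnt : o .cnt = []) (hoa : o a = z.map some) (hob : o b = List.replicate k none) :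
    Runs (loadWin a b) (state reg ok found mc (loaded V w) o)
      (state none ok found mc (loaded V ((win k z).map some ++ w)) o) (9 * k + 3) := by
  let o₁ := Function.update (Function.update (Function.update (Function.update o b []) .cnt
    (List.replicate k none)) a ((z.drop k).map some)) .tmp
    ((z.take k).map some ++ List.replicate (k - z.length) none).reverse
  have h₁ := runs_takeUnits (V := V) reg ok found mc (loaded V w) o a b hab ha ha' hb hb' k hob
  have ho₁ : Function.update (Function.update (Function.update (Function.update o b []) .cnt
      (List.replicate k none ++ o .cnt)) a ((o a).drop k)) .tmp
      (((o a).take k ++ List.replicate (k - (o a).length) none).reverse ++ o .tmp) = o₁ := by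
    simp [o₁, htmp, hcnt, hoa]
  rw [ho₁] at h₁
  have h₂ := runs_drain (V := V) none ok found mc (loaded V w) o₁ .cnt [b] (by simp)
    (by simpa using hb'.symm)
  let o₂ := Function.update (Function.update o a ((z.drop k).map some)) .tmp
    ((z.take k).map some ++ List.replicate (k - z.length) none).reverse
  have ho₂ : pour .cnt [b] o₁ = o₂ := by
    funext j
    by_cases h₁ : j = .cnt
    · subst h₁
      simp [pour, o₂, hcnt, ha'.symm]
    by_cases h₂ : j = b
    · subst h₂
      simp [pour, o₁, o₂, hab.symm, hb, hb', hob, ha'.symm]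
    · by_cases h₃ : j = a
      · subst h₃
        simp [pour, o₁, o₂, ha, ha', hab]
      · by_cases h₄ : j = .tmp
        · subst h₄
          simp [pour, h₂, o₁, o₂]
        · simp [pour, o₁, o₂, h₁, h₂, h₃, h₄]
  rw [ho₂] at h₂
  have h₃ := runs_restore (V := V) none ok found mc o₂ a ha w
  have l₁ : (o₁ .cnt).length = k := by simp [o₁, ha'.symm]
  have l₂ : (o₂ .tmp).length = k := by
    simp [o₂]
  rw [l₁] at h₂
  rw [l₂] at h₃
  refine ((h₁.seq (h₂.seq h₃)).mono (by omega)).of_eq ?_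
  congr 2
  · simp only [o₂, win, Function.update_self, List.reverse_reverse, List.map_append,
      List.map_replicate, List.map_take, List.map_map]
    rfl
  · funext j
    by_cases h₁ : j = a
    · subst h₁
      simp only [o₂, ha, hoa, List.filter_append, List.filter_reverse, filter_isSome_map_some,
        Function.update_self, Function.update_of_ne, List.reverse_reverse, ne_eq,
        not_false_eq_true, List.filter_replicate]
      simp
    · by_cases h₂ : j = .tmp
      · subst h₂
        simp [h₁, htmp]
      · simp [o₂, h₁, h₂]

/-- Push the query on the input stack of the verifier. -/
def loadQuery : SProg M V :=
  .seq (drain .qry [.tmp]) (restore .qry)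

theorem runs_loadQuery (q : List Bool) (w : List (Option Bool)) (htmp : o .tmp = [])
    (hq : o .qry = q.map some) :
    Runs loadQuery (state reg ok found mc (loaded V w) o)
      (state none ok found mc (loaded V (q.map some ++ w)) o) (6 * q.length + 2) := by
  have h₁ := runs_drain (V := V) reg ok found mc (loaded V w) o .qry [.tmp] (by simp) (by simp)
  have h₂ := runs_restore (V := V) none ok found mc (pour .qry [.tmp] o) .qry (by simp) w
  have l₂ : (pour .qry [.tmp] o .tmp) = (q.map some).reverse := by simp [pour, htmp, hq]
  simp only [l₂, hq, List.length_reverse, List.length_map] at h₁ h₂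
  refine ((h₁.seq h₂).mono (by omega)).of_eq ?_
  congr 2
  · simp
  · funext j
    by_cases h₁ : j = .qry
    · subst h₁
      simp [pour, hq, filter_isSome_map_some]
    · by_cases h₂ : j = .tmp
      · subst h₂
        simp [htmp]
      · simp [h₁, h₂, pour]

/-- The machine `V` computes the verdicts of `A` in time `T` in the length of its input. -/
def Computes (V : TM2ComputableAux (Option Bool) Bool) (A : List Bool → List Bool → List Bool → Bool)
    (T : ℕ → ℕ) : Prop :=
  ∀ x u v : List Bool, ∃ t ≤ T (x.length + u.length + v.length + 2),
    (flip bind (TM2.step V.tm.m))^[t] (some (loaded V (encodeTriple (x, u, v)))) =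
      some (haltList V.tm [V.outputAlphabet.symm (A x u v)])

/-- Run the verifier and update the flag `ok` by its verdict. -/
def verdict : SProg M V :=
  .seq runV <| .block fun _ =>
    .pop (.inr (.inl V.tm.k₁) : Idx M V)
      (fun v x => { v with
        ok := v.ok && x.elim false V.outputAlphabet
        vlab := some V.tm.main }) .halt

variable {A : List Bool → List Bool → List Bool → Bool} {T : ℕ → ℕ}

theorem runs_verdict (hV : Computes V A T) (x u v : List Bool) :
    Runs verdict (state reg ok found mc (loaded V (encodeTriple (x, u, v))) o)
      (state reg (ok && A x u v) found mc (loaded V []) o)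
      (3 * T (x.length + u.length + v.length + 2) + 3) := by
  obtain ⟨t, ht, h⟩ := hV x u v
  have h₁ := runs_runV reg ok found mc _ o t h rfl
  refine (h₁.seq (Runs.block ?_)).mono (show 3 * t + 1 + 2 ≤ _ by omega)
  simp only [effect, state, TM2.stepAux, join_inr_inl, haltList_stk_self, update_join_inr_inl,
    List.tail_cons]
  refine Prod.ext ?_ (congrArg (fun w => join mc.stk w o) (update_haltList_stk V.tm _))
  simp [loaded, initList, haltList]

/-- Run the verifier on the query and the windows of the two copies of the certificates. -/
def test : SProg M V :=
  .seq (loadWin .c₁ .len₁) <| .seq (.block fun _ => pushV none .halt) <|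
  .seq (loadWin .c₂ .len₂) <| .seq (.block fun _ => pushV none .halt) <|
  .seq loadQuery verdict

/-- The input stack of the verifier is filled from the bottom: first the witness window from `c₁`,
then the random window from `c₂`, and the query on top. -/
theorem runs_test (hV : Computes V A T) (q z₁ z₂ : List Bool) (k₁ k₂ : ℕ)
    (htmp : o .tmp = []) (hcnt : o .cnt = []) (hc₁ : o .c₁ = z₁.map some)
    (hc₂ : o .c₂ = z₂.map some) (hl₁ : o .len₁ = List.replicate k₁ none)
    (hl₂ : o .len₂ = List.replicate k₂ none) (hq : o .qry = q.map some) :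
    Runs test (state reg ok found mc (loaded V []) o)
      (state none (ok && A q (win k₂ z₂) (win k₁ z₁)) found mc (loaded V []) o)
      (9 * k₁ + 9 * k₂ + 6 * q.length + 3 * T (q.length + k₂ + k₁ + 2) + 15) := by
  have h₁ := runs_loadWin (V := V) reg ok found mc o .c₁ .len₁ (by simp) (by simp) (by simp)
    (by simp) (by simp) k₁ z₁ [] htmp hcnt hc₁ hl₁
  have h₂ := runs_pushV (V := V) none ok found mc o none ((win k₁ z₁).map some ++ [])
  have h₃ := runs_loadWin (V := V) none ok found mc o .c₂ .len₂ (by simp) (by simp) (by simp)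
    (by simp) (by simp) k₂ z₂ (none :: ((win k₁ z₁).map some ++ [])) htmp hcnt hc₂ hl₂
  have h₄ := runs_pushV (V := V) none ok found mc o none
    ((win k₂ z₂).map some ++ (none :: ((win k₁ z₁).map some ++ [])))
  have h₅ := runs_loadQuery (V := V) none ok found mc o q
    (none :: ((win k₂ z₂).map some ++ (none :: ((win k₁ z₁).map some ++ [])))) htmp hq
  have h₆ := runs_verdict none ok found mc o hV q (win k₂ z₂) (win k₁ z₁)
  simp only [length_win] at h₆
  rw [List.append_nil] at *
  exact (h₁.seq (h₂.seq (h₃.seq (h₄.seq (h₅.seq h₆))))).mono (by omega)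

/-! #### Scanning the suffixes of a stack -/

/-- Execute `body` for each suffix of the stack `a`; the stack `b` holds the scanned part. -/
def scan (a b : Own) (body : SProg M V) : SProg M V :=
  .seq body <| .seq (.loop (popReg a .halt) (fun v => v.reg.isSome)
    (.seq (.block fun _ => pushes [b]) body)) (drain b [a])

/-- A window is a prefix of a suffix, so trying all suffixes tries all windows. The function `f` is
the action of `body` on the flags `(ok, found)`. Per symbol, three steps go to the loop and three to
the final restoration of `a`, whence `B + 6`. -/
theorem runs_scan (a b : Own) (hab : a ≠ b) (body : SProg M V) (B : ℕ)
    (f : List (Option Bool) → Bool × Bool → Bool × Bool) (hob : o b = [])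
    (hbody : ∀ reg fl z y, z <:+ o a →
      Runs body (state reg fl.1 fl.2 mc vc (Function.update (Function.update o a z) b y))
        (state none (f z fl).1 (f z fl).2 mc vc (Function.update (Function.update o a z) b y)) B)
    (fl : Bool × Bool) :
    Runs (scan a b body) (state reg fl.1 fl.2 mc vc o)
      (state none ((o a).tails.foldl (fun fl z => f z fl) fl).1
        ((o a).tails.foldl (fun fl z => f z fl) fl).2 mc vc o)
      (((o a).length + 1) * (B + 6)) := by
  have loop : ∀ (z y : List (Option Bool)) (reg : Option (Option Bool)) (fl : Bool × Bool),
      z <:+ o a →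
      Runs (.loop (popReg a .halt) (fun v => v.reg.isSome) (.seq (.block fun _ => pushes [b]) body))
        (state reg fl.1 fl.2 mc vc (Function.update (Function.update o a z) b y))
        (state none (z.tails.tail.foldl (fun fl z => f z fl) fl).1
          (z.tails.tail.foldl (fun fl z => f z fl) fl).2 mc vc
          (Function.update (Function.update o a []) b (z.reverse ++ y)))
        (z.length * (B + 3) + 1) := by
    intro z
    induction z with
    | nil =>
      intro y reg fl _
      rw [List.length_nil, zero_mul, zero_add]
      refine Runs.loop_done ?_ rfl
      rw [effect_popReg]
      simp [hab, Function.update_comm hab.symm]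
    | cons x z ih =>
      intro y reg fl hz
      have hz' : z <:+ o a := (List.suffix_cons x z).trans hz
      have h₂ := hbody (some x) fl z (x :: y) hz'
      have h₁ : Runs (.block fun _ => pushes [b])
          (state (some x) fl.1 fl.2 mc vc (Function.update (Function.update o a z) b y))
          (state (some x) fl.1 fl.2 mc vc (Function.update (Function.update o a z) b (x :: y))) 2 :=
        Runs.block (by simp [effect, pushes, state, Var.sym])
      have h₃ := ih (x :: y) none (f z fl) hz'
      refine ((Runs.loop_step (s₁ := state (some x) fl.1 fl.2 mc vc
        (Function.update (Function.update o a z) b y)) ?_ rfl (h₁.seq h₂) h₃).mono ?_).of_eq ?_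
      · rw [effect_popReg]
        simp [hab, Function.update_comm hab.symm]
      · simp only [List.length_cons]
        ring_nf
        omega
      · cases z <;> simp
  have e : Function.update (Function.update o a (o a)) b [] = o := by
    rw [Function.update_eq_self, ← hob, Function.update_eq_self]
  have h₁ := hbody reg fl (o a) [] List.suffix_rfl
  have h₂ := loop (o a) [] none (f (o a) fl) List.suffix_rfl
  rw [e] at h₁ h₂
  have h₃ := runs_drain (V := V) none
    ((o a).tails.tail.foldl (fun fl z => f z fl) (f (o a) fl)).1
    ((o a).tails.tail.foldl (fun fl z => f z fl) (f (o a) fl)).2 mc vc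
    (Function.update (Function.update o a []) b ((o a).reverse ++ [])) b [a] (by simp)
    (by simpa using hab.symm)
  refine ((h₁.seq (h₂.seq h₃)).mono ?_).of_eq ?_
  · simp
    ring_nf
    omega
  · congr 1
    · cases o a <;> simp
    · cases o a <;> simp
    · funext j
      by_cases h₁ : j = b
      · subst h₁
        simp [pour, hob]
      · by_cases h₂ : j = a
        · subst h₂
          simp [pour, hab]
        · simp [pour, h₁, h₂]

/-! #### Evaluating polynomials in unary -/

/-- Push as many units on the stack `d` as the query has symbols. -/
def copyUnits (d : Own) : SProg M V :=
  .seq (.loop (popReg .qry .halt) (fun v => v.reg.isSome) <| .block fun _ =>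
      .push (.inr (.inr .tmp) : Idx M V) Var.sym
        (.push (.inr (.inr d) : Idx M V) (fun _ => none) .halt))
    (drain .tmp [.qry])

theorem runs_copyUnits (d : Own) (hd : d ≠ .tmp) (hd' : d ≠ .qry) (htmp : o .tmp = []) :
    Runs (copyUnits d) (state reg ok found mc vc o)
      (state none ok found mc vc
        (Function.update o d (List.replicate (o .qry).length none ++ o d)))
      (6 * (o .qry).length + 2) := by
  have loop : ∀ (l : List (Option Bool)) (o : Own → List (Option Bool)) (reg), o .qry = l →
      Runs (.loop (popReg .qry .halt) (fun v => v.reg.isSome) <| .block fun _ =>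
          .push (.inr (.inr .tmp) : Idx M V) Var.sym
            (.push (.inr (.inr d) : Idx M V) (fun _ => none) .halt))
        (state reg ok found mc vc o)
        (state none ok found mc vc (Function.update (Function.update (Function.update o .qry [])
          .tmp (l.reverse ++ o .tmp)) d (List.replicate l.length none ++ o d)))
        (3 * l.length + 1) := by
    intro l
    induction l with
    | nil =>
      intro o reg ho
      refine Runs.loop_done ?_ rfl
      rw [effect_popReg, ho]
      congr 1
      funext j
      by_cases h₁ : j = d
      · subst h₁
        simp [hd']
      · by_cases h₂ : j = .tmp
        · subst h₂
          simp [h₁]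
        · simp [h₁, h₂]
    | cons x l ih =>
      intro o reg ho
      let o' := Function.update (Function.update (Function.update o .qry l) .tmp (x :: o .tmp)) d
        (none :: o d)
      refine ((Runs.loop_step (s₂ := state (some x) ok found mc vc o')
        (effect_popReg _ _ _ _ _ _ _) (by simp [state, ho]) (Runs.block ?_)
        (ih o' (some x) (by simp [o', hd'.symm]))).mono (by simp; omega)).of_eq ?_
      · simp [effect, state, Var.sym, ho, o', hd, hd']
      · congr 1
        funext j
        by_cases h₁ : j = d
        · subst h₁
          simp [o', List.replicate_succ']
        · by_cases h₂ : j = .tmp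
          · subst h₂
            simp [h₁, o']
          · by_cases h₃ : j = .qry
            · subst h₃
              simp [h₁]
            · simp [h₁, h₂, h₃, o']
  let o' := Function.update (Function.update (Function.update o .qry [])
    .tmp ((o .qry).reverse ++ o .tmp)) d (List.replicate (o .qry).length none ++ o d)
  have h₂ := runs_drain (V := V) none ok found mc vc o' .tmp [.qry] (by simp) (by simp)
  refine (((loop _ o reg rfl).seq h₂).mono ?_).of_eq ?_
  · simp [o', hd.symm, htmp]
    omega
  · congr 1
    funext j
    by_cases h₁ : j = d
    · subst h₁
      simp [pour, o', hd, hd']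
    · by_cases h₂ : j = .tmp
      · subst h₂
        simp [h₁, pour, htmp]
      · by_cases h₃ : j = .qry
        · subst h₃
          simp [h₁, pour, o', htmp, hd.symm]
        · simp [h₁, h₂, h₃, o', pour]

/-- Push a copy of the length of the query on `d` for each symbol of the counter. -/
def mulUnits (d : Own) : SProg M V :=
  .loop (popReg .cnt .halt) (fun v => v.reg.isSome) (copyUnits d)

theorem runs_mulUnits (d : Own) (hd : d ≠ .tmp) (hd' : d ≠ .qry) (hd'' : d ≠ .cnt)
    (htmp : o .tmp = []) :
    Runs (mulUnits d) (state reg ok found mc vc o)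
      (state none ok found mc vc (Function.update (Function.update o .cnt []) d
        (List.replicate ((o .cnt).length * (o .qry).length) none ++ o d)))
      ((o .cnt).length * (6 * (o .qry).length + 3) + 1) := by
  generalize hl : o .cnt = l
  induction l generalizing o reg with
  | nil =>
    simp only [List.length_nil, zero_mul, zero_add]
    refine Runs.loop_done ?_ rfl
    rw [effect_popReg, hl]
    congr 1
    funext j
    by_cases h₁ : j = d
    · subst h₁
      simp [hd'']
    · simp [h₁]
  | cons x l ih =>
    have h₁ := runs_copyUnits (V := V) (some x) ok found mc vc (Function.update o .cnt l) d hd hd'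
      (by simpa using htmp)
    have h₂ := ih none (Function.update (Function.update o .cnt l) d
      (List.replicate (o .qry).length none ++ o d)) (by simp [hd.symm, htmp]) (by simp [hd''.symm])
    simp only [Function.update_of_ne hd'', Function.update_self, Function.update_of_ne hd'.symm,
      Function.update_of_ne (show Own.qry ≠ .cnt by simp)] at h₁ h₂
    refine ((Runs.loop_step ((effect_popReg _ _ _ _ _ _ _).trans (by rw [hl]; rfl)) rfl
      h₁ h₂).mono ?_).of_eq ?_
    · simp only [List.length_cons]
      ring_nf
      omega
    · congr 1
      funext j
      by_cases h₁ : j = d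
      · subst h₁
        simp only [Function.update_self, List.length_cons, ← List.append_assoc,
          List.replicate_append_replicate]
        ring_nf
      · by_cases h₂ : j = .cnt
        · subst h₂
          simp [h₁]
        · simp [h₁, h₂]

/-- Push `a` units on the stack `d`. -/
def pushUnits (d : Own) : ℕ → SStmt M V
  | 0 => .halt
  | a + 1 => .push (.inr (.inr d) : Idx M V) (fun _ => none) (pushUnits d a)

theorem effect_pushUnits (d : Own) (a : ℕ) :
    effect (pushUnits d a) (state reg ok found mc vc o) =
      state reg ok found mc vc (Function.update o d (List.replicate a none ++ o d)) := by
  induction a generalizing o with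
  | zero => simp [effect, pushUnits, state]
  | succ a ih =>
    have := ih (Function.update o d (none :: o d))
    simp only [Function.update_self, Function.update_idem] at this
    rw [List.replicate_succ', List.append_assoc, List.singleton_append, ← this]
    simp [effect, pushUnits, state]

/-- The value at `m` of the polynomial with coefficients `L`. -/
def horner (L : List ℕ) (m : ℕ) : ℕ := L.foldr (fun a k => k * m + a) 0

@[simp] theorem horner_nil (m : ℕ) : horner [] m = 0 := rfl

@[simp] theorem horner_cons (a : ℕ) (L : List ℕ) (m : ℕ) :
    horner (a :: L) m = horner L m * m + a := rfl

/-- Evaluate the polynomial with coefficients `L` at the length of the query. -/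
def evalUnits (d : Own) : List ℕ → SProg M V
  | [] => .block fun _ => .halt
  | a :: L => .seq (evalUnits d L) <| .seq (drain d [.cnt]) <| .seq (mulUnits d)
      (.block fun _ => pushUnits d a)

/-- A time bound for `evalUnits`. -/
def hornerTime : List ℕ → ℕ → ℕ
  | [], _ => 2
  | _ :: L, m => hornerTime L m + (3 * horner L m + horner L m * (6 * m + 3) + 4)

/-- Horner's scheme in unary: the value for the tail of the list is moved to the counter, multiplied
by the length of the query, and increased by the constant coefficient. -/
theorem runs_evalUnits (d : Own) (hd : d ≠ .tmp) (hd' : d ≠ .qry) (hd'' : d ≠ .cnt) (L : List ℕ)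
    (m : ℕ) (hq : (o .qry).length = m) (htmp : o .tmp = []) (hcnt : o .cnt = []) (ho : o d = []) :
    ∃ reg', Runs (evalUnits d L) (state reg ok found mc vc o)
      (state reg' ok found mc vc (Function.update o d (List.replicate (horner L m) none)))
      (hornerTime L m) := by
  induction L with
  | nil =>
    refine ⟨reg, Runs.block ?_⟩
    simp [effect, state, ← ho]
  | cons a L ih =>
    obtain ⟨reg', h₁⟩ := ih
    have h₂ := runs_drain (V := V) reg' ok found mc vc
      (Function.update o d (List.replicate (horner L m) none)) d [.cnt] (by simp)
      (by simpa using hd'')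
    have e : pour d [.cnt] (Function.update o d (List.replicate (horner L m) none)) =
        Function.update o .cnt (List.replicate (horner L m) none) := by
      funext j
      by_cases h₁ : j = d
      · subst h₁
        simp [pour, hd'', ho]
      · by_cases h₂ : j = .cnt
        · subst h₂
          simp [pour, hd''.symm, hcnt]
        · simp [pour, h₁, h₂]
    rw [e] at h₂
    have h₃ := runs_mulUnits (V := V) none ok found mc vc
      (Function.update o .cnt (List.replicate (horner L m) none)) d hd hd' hd'' (by simpa using htmp)
    refine ⟨none, ((h₁.seq (h₂.seq (h₃.seq (Runs.block
      (effect_pushUnits none ok found mc vc _ d a))))).mono ?_).of_eq ?_⟩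
    · simp [hornerTime, hq]
      omega
    · congr 1
      funext j
      by_cases h₁ : j = d
      · subst h₁
        simp [hd'', ho, hq, add_comm]
      · by_cases h₂ : j = .cnt
        · subst h₂
          simp [hd''.symm, hcnt]
        · simp [h₁, h₂]

/-! #### Answering a query -/

/-- Test all windows of the second copy of the certificates. -/
def tryWitness : SProg M V :=
  .seq (.block fun _ => .load (fun v => { v with ok := true }) .halt) <|
  .seq (scan .c₂ .d₂ test)
    (.block fun _ => .load (fun v => { v with found := v.found || v.ok }) .halt)

/-- A time bound for `test`. -/
def testTime (T : ℕ → ℕ) (k₁ k₂ m : ℕ) : ℕ := 9 * k₁ + 9 * k₂ + 6 * m + 3 * T (m + k₂ + k₁ + 2) + 15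

theorem foldl_tails_map_some {β : Type*} (f : List (Option Bool) → β → β) (c : List Bool) (b : β) :
    (c.map some).tails.foldl (fun b z => f z b) b =
      c.tails.foldl (fun b z => f (z.map some) b) b := by
  induction c generalizing b with
  | nil => rfl
  | cons x c ih => simpa using ih _

theorem foldl_and (g : List Bool → Bool) (l : List (List Bool)) (fl : Bool × Bool) :
    l.foldl (fun fl z => (fl.1 && g z, fl.2)) fl = (fl.1 && l.all g, fl.2) := by
  induction l generalizing fl with
  | nil => simp
  | cons x l ih => simp [ih, Bool.and_assoc]

/-- The first flag is overwritten by every candidate, so only the second one is worth following;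
`runs_scan_tryWitness` accordingly leaves the final `ok'` unspecified. -/
theorem foldl_or (g : List Bool → Bool) (l : List (List Bool)) (fl : Bool × Bool) :
    (l.foldl (fun fl z => (g z, fl.2 || g z)) fl).2 = (fl.2 || l.any g) := by
  induction l generalizing fl with
  | nil => simp
  | cons x l ih => simp [ih, Bool.or_assoc]

/-- `runs_scan` speaks of stacks that may hold blanks; on suffixes of a certificate there are none,
so `getD false` recovers the bits without loss. -/
theorem eq_map_some_of_suffix {z : List (Option Bool)} {c : List Bool} (h : z <:+ c.map some) :
    z = (z.map (·.getD false)).map some := by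
  rw [List.map_map]
  conv_lhs => rw [← List.map_id z]
  refine List.map_congr_left fun x hx => ?_
  obtain ⟨b, -, rfl⟩ := List.mem_map.1 (h.subset hx)
  rfl

theorem map_getD_map_some (z : List Bool) :
    (z.map some).map (fun x : Option Bool => x.getD false) = z := by
  simp

theorem runs_scan_test (hV : Computes V A T) (q c z₁ : List Bool) (k₁ k₂ : ℕ)
    (htmp : o .tmp = []) (hcnt : o .cnt = []) (hc₁ : o .c₁ = z₁.map some)
    (hc₂ : o .c₂ = c.map some) (hd₂ : o .d₂ = []) (hl₁ : o .len₁ = List.replicate k₁ none)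
    (hl₂ : o .len₂ = List.replicate k₂ none) (hq : o .qry = q.map some) :
    Runs (scan .c₂ .d₂ test) (state reg ok found mc (loaded V []) o)
      (state none (ok && c.tails.all fun z₂ => A q (win k₂ z₂) (win k₁ z₁)) found mc (loaded V []) o)
      ((c.length + 1) * (testTime T k₁ k₂ q.length + 6)) := by
  have h := runs_scan (V := V) reg mc (loaded V []) o .c₂ .d₂ (by simp) test
    (testTime T k₁ k₂ q.length)
    (fun z fl => (fl.1 && A q (win k₂ (z.map (·.getD false))) (win k₁ z₁), fl.2)) hd₂ ?_ (ok, found)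
  · rw [hc₂, foldl_tails_map_some (fun z fl =>
      (fl.1 && A q (win k₂ (z.map (·.getD false))) (win k₁ z₁), fl.2))] at h
    simp only [map_getD_map_some, foldl_and, List.length_map] at h
    exact h
  · intro reg fl z y hz
    rw [hc₂] at hz
    exact runs_test reg fl.1 fl.2 mc (Function.update (Function.update o .c₂ z) .d₂ y) hV q z₁ (z.map (·.getD false)) k₁ k₂ (by simpa using htmp)
      (by simpa using hcnt) (by simpa using hc₁) (by simpa using eq_map_some_of_suffix hz)
      (by simpa using hl₁) (by simpa using hl₂) (by simpa using hq)

theorem runs_tryWitness (hV : Computes V A T) (q c z₁ : List Bool) (k₁ k₂ : ℕ)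
    (htmp : o .tmp = []) (hcnt : o .cnt = []) (hc₁ : o .c₁ = z₁.map some)
    (hc₂ : o .c₂ = c.map some) (hd₂ : o .d₂ = []) (hl₁ : o .len₁ = List.replicate k₁ none)
    (hl₂ : o .len₂ = List.replicate k₂ none) (hq : o .qry = q.map some) :
    Runs tryWitness (state reg ok found mc (loaded V []) o)
      (state none (c.tails.all fun z₂ => A q (win k₂ z₂) (win k₁ z₁))
        (found || c.tails.all fun z₂ => A q (win k₂ z₂) (win k₁ z₁)) mc (loaded V []) o)
      ((c.length + 1) * (testTime T k₁ k₂ q.length + 6) + 4) := by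
  have h := runs_scan_test reg true found mc o hV q c z₁ k₁ k₂ htmp hcnt hc₁ hc₂ hd₂ hl₁ hl₂ hq
  rw [Bool.true_and] at h
  exact ((Runs.block (s' := state reg true found mc (loaded V []) o) rfl).seq
    (h.seq (Runs.block rfl))).mono (by omega)

theorem runs_scan_tryWitness (hV : Computes V A T) (q c : List Bool) (k₁ k₂ : ℕ)
    (htmp : o .tmp = []) (hcnt : o .cnt = []) (hc₁ : o .c₁ = c.map some)
    (hc₂ : o .c₂ = c.map some) (hd₁ : o .d₁ = []) (hd₂ : o .d₂ = [])
    (hl₁ : o .len₁ = List.replicate k₁ none)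
    (hl₂ : o .len₂ = List.replicate k₂ none) (hq : o .qry = q.map some) :
    ∃ ok', Runs (scan .c₁ .d₁ tryWitness) (state reg ok found mc (loaded V []) o)
      (state none ok' (found || c.tails.any fun z₁ => c.tails.all fun z₂ =>
        A q (win k₂ z₂) (win k₁ z₁)) mc (loaded V []) o)
      ((c.length + 1) * ((c.length + 1) * (testTime T k₁ k₂ q.length + 6) + 4 + 6)) := by
  have h := runs_scan (V := V) reg mc (loaded V []) o .c₁ .d₁ (by simp) tryWitness
    ((c.length + 1) * (testTime T k₁ k₂ q.length + 6) + 4)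
    (fun z fl => (c.tails.all fun z₂ => A q (win k₂ z₂) (win k₁ (z.map (·.getD false))),
      fl.2 || c.tails.all fun z₂ => A q (win k₂ z₂) (win k₁ (z.map (·.getD false))))) hd₁ ?_
      (ok, found)
  · rw [hc₁, foldl_tails_map_some (fun z fl =>
      (c.tails.all fun z₂ => A q (win k₂ z₂) (win k₁ (z.map (·.getD false))),
      fl.2 || c.tails.all fun z₂ => A q (win k₂ z₂) (win k₁ (z.map (·.getD false)))))] at h
    simp only [map_getD_map_some, List.length_map] at h
    rw [foldl_or (fun z => c.tails.all fun z₂ => A q (win k₂ z₂) (win k₁ z))] at h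
    exact ⟨_, h⟩
  · intro reg fl z y hz
    rw [hc₁] at hz
    exact runs_tryWitness reg fl.1 fl.2 mc
      (Function.update (Function.update o .c₁ z) .d₁ y) hV q c (z.map (·.getD false)) k₁ k₂
      (by simpa using htmp) (by simpa using hcnt) (by simpa using eq_map_some_of_suffix hz)
      (by simpa using hc₂) (by simpa using hd₂) (by simpa using hl₁) (by simpa using hl₂)
      (by simpa using hq)

/-- Pop the query of the oracle machine to the scratch stack. -/
def popQuery : SProg M V :=
  .loop (.pop (.inl M.kq : Idx M V)
      (fun v x => { v with reg := x.map fun s => some (M.queryAlphabet s) }) .halt)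
    (fun v => v.reg.isSome) (.block fun _ => pushes [.tmp])

theorem runs_popQuery (l : Option M.tm.Λ) (v : M.tm.σ) (S : ∀ k, List (M.tm.Γ k)) :
    Runs popQuery (state reg ok found (M := M) ⟨l, v, S⟩ vc o)
      (state none ok found (M := M) ⟨l, v, Function.update S M.kq []⟩ vc
        (Function.update o .tmp (((S M.kq).map fun s => some (M.queryAlphabet s)).reverse ++ o .tmp)))
      (3 * (S M.kq).length + 1) := by
  generalize hl : S M.kq = y
  induction y generalizing S reg o with
  | nil =>
    refine Runs.loop_done ?_ rfl
    simp [effect, state, hl]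
  | cons x y ih =>
    refine ((Runs.loop_step (s₁ := state (some (some (M.queryAlphabet x))) ok found
      (⟨l, v, Function.update S M.kq y⟩ : M.Cfg) vc o) ?_ rfl (Runs.block
      (effect_pushes (V := V) _ _ _ _ _ [.tmp] (by simp) _))
      (ih _ _ (Function.update S M.kq y) (by simp))).mono (by simp; omega)).of_eq ?_
    · simp [effect, state, hl]
    · congr 1
      · simp
      · funext j
        by_cases h₁ : j = .tmp
        · subst h₁
          simp
        · simp [h₁]

/-- The work stacks between the steps of the oracle machine. -/
def work (c : List Bool) : Own → List (Option Bool)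
  | .c₁ => c.map some
  | .c₂ => c.map some
  | _ => []

/-- Answer the query of the oracle machine. -/
def answer (P R : List ℕ) : SProg M V :=
  .seq popQuery <| .seq (drain .tmp [.qry]) <| .seq (evalUnits .len₁ P) <|
  .seq (evalUnits .len₂ R) <| .seq (.block fun _ => .load (fun v => { v with found := false }) .halt) <|
  .seq (scan .c₁ .d₁ tryWitness) <| .seq (drain .qry []) <| .seq (drain .len₁ []) <|
  .seq (drain .len₂ []) <|
  .block fun _ => .load (fun v => { v with
    mlab := some (if v.found = true then M.yesLabel else M.noLabel) }) .halt

/-- The answer to the query `q` according to the certificates `c`: there is a window of `c` which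
passes the test with all windows of `c`. -/
def verdictOn (A : List Bool → List Bool → List Bool → Bool) (p t : ℕ → ℕ) (c q : List Bool) :
    Bool :=
  c.tails.any fun z₁ => c.tails.all fun z₂ => A q (win (t q.length) z₂) (win (p q.length) z₁)

/-- A time bound for `answer`. -/
def answerTime (T : ℕ → ℕ) (P R : List ℕ) (L m : ℕ) : ℕ :=
  9 * m + 3 * horner P m + 3 * horner R m + hornerTime P m + hornerTime R m + 9 +
    (L + 1) * ((L + 1) * (testTime T (horner P m) (horner R m) m + 6) + 10)

theorem runs_answer (hV : Computes V A T) (P R : List ℕ) (c : List Bool) :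
    ∃ reg' ok' found', Runs (answer P R) (state reg ok found mc (loaded V []) (work c))
      (state reg' ok' found'
        (⟨some (if verdictOn A (horner P) (horner R) c (M.queryWord mc) = true then M.yesLabel
          else M.noLabel), mc.var, Function.update mc.stk M.kq []⟩ : M.Cfg) (loaded V []) (work c))
      (answerTime T P R c.length (M.queryWord mc).length) := by
  obtain ⟨l, v, S⟩ := mc
  set q := M.queryWord ⟨l, v, S⟩ with hq
  set mc' : M.Cfg := ⟨l, v, Function.update S M.kq []⟩ with hmc'
  set m := q.length with hm
  have hSq : (S M.kq).length = m := by simp [hm, hq, OracleTM.queryWord]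
  let o₁ := Function.update (work c) .tmp (q.map some).reverse
  let o₂ := Function.update (work c) .qry (q.map some)
  let o₃ := Function.update o₂ .len₁ (List.replicate (horner P m) none)
  let o₄ := Function.update o₃ .len₂ (List.replicate (horner R m) none)
  have h₁ := runs_popQuery (V := V) reg ok found (loaded V []) (work c) l v S
  have e₁ : Function.update (work c) .tmp
      (((S M.kq).map fun s => some (M.queryAlphabet s)).reverse ++ work c .tmp) = o₁ := by
    simp [o₁, work, hq, OracleTM.queryWord, Function.comp_def]
  rw [e₁, hSq] at h₁
  have h₂ := runs_drain (V := V) none ok found mc' (loaded V []) o₁ .tmp [.qry] (by simp) (by simp)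
  have e₂ : pour .tmp [.qry] o₁ = o₂ := by
    funext j
    cases j <;> simp [pour, o₁, o₂, work]
  have l₂ : (o₁ .tmp).length = m := by simp [o₁, hm]
  rw [e₂, l₂] at h₂
  obtain ⟨r₃, h₃⟩ := runs_evalUnits (V := V) none ok found mc' (loaded V []) o₂ .len₁ (by simp)
    (by simp) (by simp) P m (by simp [o₂, hm]) (by simp [o₂, work]) (by simp [o₂, work])
    (by simp [o₂, work])
  obtain ⟨r₄, h₄⟩ := runs_evalUnits (V := V) r₃ ok found mc' (loaded V []) o₃ .len₂ (by simp)
    (by simp) (by simp) R m (by simp [o₃, o₂, hm]) (by simp [o₃, o₂, work]) (by simp [o₃, o₂, work])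
    (by simp [o₃, o₂, work])
  have h₅ : Runs (.block fun _ => .load (fun v => { v with found := false }) .halt)
      (state r₄ ok found mc' (loaded V []) o₄) (state r₄ ok false mc' (loaded V []) o₄) 2 :=
    Runs.block rfl
  obtain ⟨ok', h₆⟩ := runs_scan_tryWitness r₄ ok false mc' o₄ hV q c (horner P m) (horner R m)
    (by simp [o₄, o₃, o₂, work]) (by simp [o₄, o₃, o₂, work]) (by simp [o₄, o₃, o₂, work])
    (by simp [o₄, o₃, o₂, work]) (by simp [o₄, o₃, o₂, work]) (by simp [o₄, o₃, o₂, work])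
    (by simp [o₄, o₃, o₂]) (by simp [o₄, o₃, o₂]) (by simp [o₄, o₃, o₂])
  rw [Bool.false_or] at h₆
  set b := c.tails.any fun z₁ => c.tails.all fun z₂ =>
    A q (win (horner R m) z₂) (win (horner P m) z₁) with hb
  have h₇ := runs_drain (V := V) none ok' b mc' (loaded V []) o₄ .qry [] (by simp) (by simp)
  let o₅ := pour .qry [] o₄
  have h₈ := runs_drain (V := V) none ok' b mc' (loaded V []) o₅ .len₁ [] (by simp) (by simp)
  let o₆ := pour .len₁ [] o₅
  have h₉ := runs_drain (V := V) none ok' b mc' (loaded V []) o₆ .len₂ [] (by simp) (by simp)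
  have e₉ : pour .len₂ [] o₆ = work c := by
    funext j
    cases j <;> simp [pour, o₆, o₅, o₄, o₃, o₂, work]
  have l₇ : (o₄ .qry).length = m := by simp [o₄, o₃, o₂, hm]
  have l₈ : (o₅ .len₁).length = horner P m := by simp [pour, o₅, o₄, o₃]
  have l₉ : (o₆ .len₂).length = horner R m := by simp [pour, o₆, o₅, o₄]
  rw [l₇] at h₇
  rw [l₈] at h₈
  rw [e₉, l₉] at h₉
  refine ⟨none, ok', b, ((h₁.seq (h₂.seq (h₃.seq (h₄.seq (h₅.seq (h₆.seq (h₇.seq (h₈.seq (h₉.seq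
    (Runs.block rfl)))))))))).mono ?_).of_eq ?_⟩
  · simp only [answerTime]
    have e : ∀ x : ℕ, x + 4 + 6 = x + 10 := fun _ => rfl
    rw [e]
    omega
  · rfl

/-! #### Running the oracle machine -/

/-- `run` recurses on the last step. The first step can be split off because the answers of this
oracle do not depend on the time. -/
theorem run_const_succ (a : List Bool → Bool) (k : ℕ) :
    M.run (fun _ => a) mc (k + 1) = M.run (fun _ => a) ((M.step a mc).getD mc) k := by
  induction k with
  | zero => rfl
  | succ k ih =>
    rw [OracleTM.run, ih]
    rfl

theorem run_of_halted (B : ℕ → List Bool → Bool) (h : mc.l = none) (k : ℕ) :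
    M.run B mc k = mc := by
  induction k with
  | zero => rfl
  | succ k ih =>
    obtain ⟨l, v, S⟩ := mc
    subst h
    rw [OracleTM.run, ih]
    simp [OracleTM.step]

theorem horner_mono (L : List ℕ) : Monotone (horner L) := by
  intro m n h
  induction L with
  | nil => simp
  | cons a L ih =>
    simp only [horner_cons]
    gcongr

theorem hornerTime_mono (L : List ℕ) : Monotone (hornerTime L) := by
  intro m n h
  induction L with
  | nil => simp [hornerTime]
  | cons a L ih =>
    have := horner_mono L h
    simp only [hornerTime]
    gcongr

theorem answerTime_mono (hT : Monotone T) (P R : List ℕ) (L : ℕ) :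
    Monotone (answerTime T P R L) := by
  intro m n h
  have h₁ := horner_mono P h
  have h₂ := horner_mono R h
  have h₃ := hornerTime_mono P h
  have h₄ := hornerTime_mono R h
  have h₅ : T (m + horner R m + horner P m + 2) ≤ T (n + horner R n + horner P n + 2) :=
    hT (by omega)
  simp only [answerTime, testTime]
  gcongr

open Classical in
/-- Run the oracle machine until it halts. -/
def runM (P R : List ℕ) : SProg M V :=
  .loop .halt (fun v => v.mlab.isSome) <|
    .ite (fun v => decide (v.mlab = some M.query)) (answer P R) stepM

theorem runs_runM (hV : Computes V A T) (hT : Monotone T) (P R : List ℕ) (c : List Bool) (m k : ℕ)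
    (hm : ∀ i < k, (M.queryWord
      (M.run (fun _ => verdictOn A (horner P) (horner R) c) mc i)).length ≤ m)
    (hk : (M.run (fun _ => verdictOn A (horner P) (horner R) c) mc k).l = none) :
    ∃ reg' ok' found', Runs (runM P R) (state reg ok found mc (loaded V []) (work c))
      (state reg' ok' found' (M.run (fun _ => verdictOn A (horner P) (horner R) c) mc k)
        (loaded V []) (work c))
      (k * (answerTime T P R c.length m + 4) + 1) := by
  classical
  induction k generalizing reg ok found mc with
  | zero =>
    rw [zero_mul, zero_add]
    refine ⟨reg, ok, found, Runs.loop_done rfl ?_⟩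
    simpa [state] using hk
  | succ k ih =>
    rcases hl : mc.l with _ | l
    · rw [run_of_halted mc _ hl]
      refine ⟨reg, ok, found, Runs.mono (t := 1) (Runs.loop_done rfl ?_) (by omega)⟩
      simp [state, hl]
    have step : ∀ mc', (M.step (verdictOn A (horner P) (horner R) c) mc).getD mc = mc' →
        (∃ reg' ok' found', Runs (.ite (fun v => decide (v.mlab = some M.query)) (answer P R) stepM)
          (state reg ok found mc (loaded V []) (work c))
          (state reg' ok' found' mc' (loaded V []) (work c))
          -- The summand 3 covers an ordinary step: one for the conditional and two for `stepM`. The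
          -- head of the loop adds one more.
          (answerTime T P R c.length m + 3)) →
        ∃ reg' ok' found', Runs (runM P R) (state reg ok found mc (loaded V []) (work c))
          (state reg' ok' found' (M.run (fun _ => verdictOn A (horner P) (horner R) c) mc (k + 1))
            (loaded V []) (work c))
          ((k + 1) * (answerTime T P R c.length m + 4) + 1) := by
      rintro mc' h ⟨r₁, o₁, f₁, h₁⟩
      have e := run_const_succ mc (verdictOn A (horner P) (horner R) c)
      rw [h] at e
      obtain ⟨r₂, o₂, f₂, h₂⟩ := ih r₁ o₁ f₁ mc'
        (fun i hi => by rw [← e]; exact hm (i + 1) (by omega)) (by rw [← e]; exact hk)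
      refine ⟨r₂, o₂, f₂, ?_⟩
      rw [e]
      refine (Runs.loop_step rfl (by simp [state, effect, hl]) h₁ h₂).mono ?_
      rw [add_mul]
      omega
    by_cases hq : l = M.query
    · subst hq
      obtain ⟨r₁, o₁, f₁, h₁⟩ := runs_answer reg ok found mc hV P R c
      refine step _ ?_ ⟨r₁, o₁, f₁, ((Runs.ite_true (by simp [state, hl]) h₁).mono ?_)⟩
      · rw [OracleTM.step, if_pos hl]
        rfl
      · have := answerTime_mono hT P R c.length (hm 0 (by omega))
        simp only [OracleTM.run] at this
        omega
    · refine step _ ?_ ⟨reg, ok, found, ((Runs.ite_false (by simp [state, hl, hq])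
        (runs_stepM reg ok found mc (loaded V []) (work c) hl)).mono (by omega))⟩
      obtain ⟨l', v, S⟩ := mc
      dsimp only at hl
      subst hl
      rw [OracleTM.step, if_neg (by simpa using hq)]
      rfl

/-! ### Growth of the stacks of the oracle machine -/

/-- The number of symbols a statement can push on a stack. -/
def pushCount {K : Type*} {Γ : K → Type*} {Λ σ : Type*} : TM2.Stmt Γ Λ σ → ℕ
  | .push _ _ q => pushCount q + 1
  | .peek _ _ q => pushCount q
  | .pop _ _ q => pushCount q
  | .load _ q => pushCount q
  | .branch _ q₁ q₂ => pushCount q₁ + pushCount q₂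
  | .goto _ => 0
  | .halt => 0

theorem length_stepAux_le {K : Type*} [DecidableEq K] {Γ : K → Type*} {Λ σ : Type*}
    (q : TM2.Stmt Γ Λ σ) (v : σ) (S : ∀ k, List (Γ k)) (k : K) :
    ((TM2.stepAux q v S).stk k).length ≤ (S k).length + pushCount q := by
  induction q generalizing v S with
  | push j f q ih =>
    refine (ih v (Function.update S j (f v :: S j))).trans ?_
    by_cases h : k = j
    · subst h
      simp [pushCount]
      omega
    · simp [pushCount, h]
  | peek j f q ih => exact ih _ _
  | pop j f q ih =>
    refine (ih _ _).trans ?_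
    by_cases h : k = j
    · subst h
      simp [pushCount]
    · simp [pushCount, h]
  | load f q ih => exact ih _ _
  | branch f q₁ q₂ h₁ h₂ =>
    simp only [TM2.stepAux, pushCount]
    cases f v
    · exact (h₂ v S).trans (by omega)
    · exact (h₁ v S).trans (by omega)
  | goto f => simp
  | halt => simp

variable (M) in
/-- The stacks of the oracle machine grow by at most a constant at each step. -/
theorem exists_length_run_le : ∃ d : ℕ, ∀ (B : ℕ → List Bool → Bool) (mc : M.Cfg) (i : ℕ)
    (k : M.tm.K), ((M.run B mc i).stk k).length ≤ (mc.stk k).length + i * d := by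
  have := M.tm.ΛFin
  refine ⟨Finset.univ.sup fun l => pushCount (M.tm.m l), fun B mc i k => ?_⟩
  set d := Finset.univ.sup fun l => pushCount (M.tm.m l) with hd
  induction i with
  | zero => simp [OracleTM.run]
  | succ i ih =>
    rw [OracleTM.run]
    generalize M.run B mc i = mc' at *
    have : (((M.step (B i) mc').getD mc').stk k).length ≤ (mc'.stk k).length + d := by
      rw [OracleTM.step]
      by_cases h : mc'.l = some M.query
      · rw [if_pos h, Option.getD_some]
        by_cases hk : k = M.kq
        · subst hk
          simp
        · simp [hk]
      · rw [if_neg h]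
        obtain ⟨l, v, S⟩ := mc'
        cases l with
        | none => simp
        | some l =>
          refine (length_stepAux_le (M.tm.m l) v S k).trans (Nat.add_le_add_left ?_ _)
          exact Finset.le_sup (f := fun l => pushCount (M.tm.m l)) (Finset.mem_univ l)
    rw [add_mul]
    omega

theorem length_init_le (x : List Bool) (k : M.tm.K) : ((M.init x).stk k).length ≤ x.length := by
  by_cases hk : k = M.tm.k₀
  · subst hk
    rw [OracleTM.init, initList_stk_self]
    simp
  · simp [OracleTM.init, initList, hk]

/-! #### Reading the input -/

/-- Move a string from the input to the scratch stack, up to a separator. -/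
def takeInput : SProg M V :=
  .loop (popReg .inp .halt) (fun v => v.sym.isSome) (.block fun _ => pushes [.tmp])

/-- `Var.sym` does not distinguish a separator from an exhausted stack, so the same loop reads all
three arguments; a separator is consumed. -/
theorem runs_takeInput (x : List Bool) (z : List (Option Bool)) (hz : z.head?.getD none = none)
    (ho : o .inp = x.map some ++ z) :
    Runs takeInput (state reg ok found mc vc o)
      (state z.head? ok found mc vc (Function.update (Function.update o .inp z.tail) .tmp
        ((x.map some).reverse ++ o .tmp))) (3 * x.length + 1) := by
  induction x generalizing reg o with
  | nil =>
    refine Runs.loop_done ((effect_popReg _ _ _ _ _ _ _).trans ?_) ?_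
    · simp only [List.map_nil, List.nil_append] at ho
      rw [ho]
      congr 1
      funext j
      by_cases h : j = .tmp
      · subst h
        simp
      · simp [h]
    · simp [state, Var.sym, hz]
  | cons b x ih =>
    refine ((Runs.loop_step (s₁ := state (some (some b)) ok found mc vc
      (Function.update o .inp (x.map some ++ z))) ?_ rfl (Runs.block
      (effect_pushes (V := V) _ _ _ _ _ [.tmp] (by simp) _)) (ih _ _ (by simp))).mono
      (by simp; omega)).of_eq ?_
    · rw [effect_popReg, ho]
      rfl
    · congr 1
      funext j
      by_cases h₁ : j = .tmp
      · subst h₁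
        simp
      · by_cases h₂ : j = .inp
        · subst h₂
          simp
        · simp [h₁, h₂]

/-- Move a string from the scratch stack to the input stack of the oracle machine. -/
def loadM : SProg M V :=
  .loop (popReg .tmp .halt) (fun v => v.reg.isSome) <| .block fun v =>
    .push (.inl M.tm.k₀ : Idx M V) (fun _ => M.inputAlphabet.symm (v.sym.getD false)) .halt

theorem runs_loadM (l y : List Bool) (ho : o .tmp = l.map some) :
    Runs loadM (state reg ok found (M.init y) vc o)
      (state none ok found (M.init (l.reverse ++ y)) vc (Function.update o .tmp []))
      (3 * l.length + 1) := by
  induction l generalizing reg o y with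
  | nil =>
    refine Runs.loop_done ((effect_popReg _ _ _ _ _ _ _).trans ?_) rfl
    rw [ho]
    rfl
  | cons b l ih =>
    refine ((Runs.loop_step (s₁ := state (some (some b)) ok found (M.init y) vc
      (Function.update o .tmp (l.map some)))
      (s₂ := state (some (some b)) ok found (M.init (b :: y)) vc
      (Function.update o .tmp (l.map some))) ?_ rfl (Runs.block ?_) (ih _ _ (b :: y) (by simp))).mono
      (by simp; omega)).of_eq ?_
    · rw [effect_popReg, ho]
      rfl
    · simp only [effect, state, TM2.stepAux, OracleTM.init, join_inl, initList_stk_self,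
        update_join_inl, update_initList_stk, List.map_cons]
      rfl
    · simp

/-- Distribute the input to the stacks. -/
def readInput : SProg M V :=
  .seq takeInput <| .seq loadM <| .seq takeInput <| .seq takeInput <| drain .tmp [.c₁, .c₂]

/-- The work stacks at the beginning. -/
def inputWork (s : List (Option Bool)) : Own → List (Option Bool)
  | .inp => s
  | _ => []

/-- The two certificates are piled on the scratch stack with no separator between them, so a single
`drain` writes `u ++ v` on both certificate stacks. -/
theorem runs_readInput (x u v : List Bool) :
    Runs readInput (state reg ok found (M.init []) vc (inputWork (encodeTriple (x, u, v))))
      (state none ok found (M.init x) vc (work (u ++ v)))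
      (6 * x.length + 6 * u.length + 6 * v.length + 5) := by
  have h₁ := runs_takeInput reg ok found (M.init []) vc (inputWork (encodeTriple (x, u, v))) x
    (none :: (u.map some ++ none :: v.map some)) rfl rfl
  let o₁ := inputWork (u.map some ++ none :: v.map some)
  have h₂ := runs_loadM (M := M) (some none) ok found vc (Function.update o₁ .tmp (x.map some).reverse)
    x.reverse [] (by simp)
  have e₁ : Function.update (Function.update (inputWork (encodeTriple (x, u, v))) .inp
      (none :: (u.map some ++ none :: v.map some)).tail) .tmp
      ((x.map some).reverse ++ inputWork (encodeTriple (x, u, v)) .tmp) =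
      Function.update o₁ .tmp (x.map some).reverse := by
    funext j
    cases j <;> simp [o₁, inputWork]
  rw [e₁] at h₁
  have e₂ : Function.update (Function.update o₁ .tmp (x.map some).reverse) .tmp [] = o₁ := by
    funext j
    cases j <;> simp [o₁, inputWork]
  simp only [e₂, List.reverse_reverse, List.append_nil, List.length_reverse] at h₂
  have h₃ := runs_takeInput none ok found (M.init x) vc o₁ u (none :: v.map some) rfl rfl
  let o₂ := Function.update (Function.update o₁ .inp (v.map some)) .tmp (u.map some).reverse
  have e₃ : Function.update (Function.update o₁ .inp (none :: v.map some).tail) .tmp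
      ((u.map some).reverse ++ o₁ .tmp) = o₂ := by
    funext j
    cases j <;> simp [o₁, o₂, inputWork]
  rw [e₃] at h₃
  have h₄ := runs_takeInput (some none) ok found (M.init x) vc o₂ v [] rfl (by simp [o₂])
  let o₃ := Function.update (inputWork []) .tmp ((u ++ v).map some).reverse
  have e₄ : Function.update (Function.update o₂ .inp (([] : List (Option Bool)).tail)) .tmp
      ((v.map some).reverse ++ o₂ .tmp) = o₃ := by
    funext j
    cases j <;> simp [o₁, o₂, o₃, inputWork]
  rw [e₄] at h₄
  have h₅ := runs_drain (V := V) none ok found (M.init x) vc o₃ .tmp [.c₁, .c₂] (by simp) (by simp)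
  have e₅ : pour .tmp [.c₁, .c₂] o₃ = work (u ++ v) := by
    funext j
    cases j <;> simp [pour, o₃, inputWork, work]
  have l₅ : (o₃ .tmp).length = u.length + v.length := by simp [o₃]; omega
  rw [e₅, l₅] at h₅
  exact (h₁.seq (h₂.seq (h₃.seq (h₄.seq h₅)))).mono (by omega)

/-! #### The whole machine -/

variable (M V) in
/-- The internal memory at the beginning and at the end. -/
def initVar : Var M V :=
  ⟨none, false, false, some M.tm.main, M.tm.initialState, some V.tm.main, V.tm.initialState⟩

/-- The program of the simulating machine. -/
def simProg (P R : List ℕ) : SProg M V :=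
  .seq readInput <| .seq (runM P R) <| .seq (drain .c₁ []) <| .seq (drain .c₂ []) <|
    .block fun _ => .load (fun _ => initVar M V) .halt

variable (M V) in
/-- The simulating machine. -/
def simMachine (P R : List ℕ) : FinTM2 :=
  letI := M.tm.kFin
  letI := V.tm.kFin
  letI := Fintype.ofFinite (Var M V)
  haveI := finite_pos (simProg (M := M) (V := V) P R)
  letI := Fintype.ofFinite (Pos (simProg (M := M) (V := V) P R))
  { K := Idx M V
    k₀ := .inr (.inr .inp)
    k₁ := .inl M.tm.k₁
    Γ := Sym M V
    Λ := Pos (simProg (M := M) (V := V) P R)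
    main := entry _
    σ := Var M V
    initialState := initVar M V
    Γk₀Fin := inferInstanceAs (Fintype (Option Bool))
    m := code _ none id }

theorem initList_simMachine (P R : List ℕ) (s : List (Option Bool)) :
    initList (simMachine M V P R) s = ⟨some (entry (simProg (M := M) (V := V) P R)),
      (state none false false (M.init []) (loaded V []) (inputWork s)).1,
      (state none false false (M.init []) (loaded V []) (inputWork s)).2⟩ := by
  refine congrArg (TM2.Cfg.mk _ _) ?_
  funext k
  rcases k with k | k | k
  · exact (initList_nil_stk M.tm k).symm
  · exact (initList_nil_stk V.tm k).symm
  · cases k <;> rfl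

/-- The output stack of the simulating machine is that of `M`, so the verdict is already in place
when `M` halts; only the work stacks and the memory have to be reset. -/
theorem haltList_simMachine (P R : List ℕ) (b : Bool) (S : ∀ k, List (Sym M V k))
    (h₁ : ∀ k, S (.inl k) = (M.halted b).stk k) (h₂ : ∀ k, S (.inr k) = []) :
    haltList (simMachine M V P R) [M.outputAlphabet.symm b] = ⟨none, initVar M V, S⟩ := by
  refine congrArg (TM2.Cfg.mk _ _) ?_
  funext k
  rcases k with k | k
  · rw [h₁]
    by_cases hk : k = M.tm.k₁
    · subst hk
      exact (haltList_stk_self (simMachine M V P R) _).trans (haltList_stk_self M.tm _).symm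
    · simp only [OracleTM.halted, haltList, dif_neg hk]
      exact dif_neg fun h => hk (Sum.inl_injective h)
  · rw [h₂]
    exact dif_neg fun h => Sum.inr_ne_inl h

/-- A time bound for the simulating machine. -/
def simTime (T p : ℕ → ℕ) (P R : List ℕ) (d N : ℕ) : ℕ :=
  p N * (answerTime T P R N (N + p N * d) + 4) + 12 * N + 10

theorem answerTime_mono_left (P R : List ℕ) (m : ℕ) : Monotone fun L => answerTime T P R L m := by
  intro a b h
  simp only [answerTime]
  gcongr

theorem exists_runs_simProg (hV : Computes V A T) (hT : Monotone T) {p : ℕ → ℕ} (hp : Monotone p)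
    (P R : List ℕ) {d : ℕ}
    (hd : ∀ (B : ℕ → List Bool → Bool) (mc : M.Cfg) (i : ℕ) (k : M.tm.K),
      ((M.run B mc i).stk k).length ≤ (mc.stk k).length + i * d)
    (x u v : List Bool) (b : Bool)
    (hb : M.OutputsWithin (fun _ => verdictOn A (horner P) (horner R) (u ++ v)) x b (p x.length)) :
    Runs (simProg P R) (state none false false (M.init []) (loaded V [])
        (inputWork (encodeTriple (x, u, v))))
      (initVar M V, join (M.halted b).stk (loaded V []).stk fun _ => [])
      (simTime T p P R d (x.length + u.length + v.length + 2)) := by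
  set N := x.length + u.length + v.length + 2 with hN
  have h₁ := runs_readInput (M := M) none false false (loaded V []) x u v
  have hm : ∀ i < p x.length, (M.queryWord (M.run (fun _ => verdictOn A (horner P) (horner R)
      (u ++ v)) (M.init x) i)).length ≤ N + p N * d := by
    intro i hi
    rw [OracleTM.queryWord, List.length_map]
    refine (hd _ _ _ _).trans (add_le_add ((length_init_le x _).trans (by omega)) ?_)
    exact Nat.mul_le_mul_right _ (hi.le.trans (hp (by omega)))
  obtain ⟨r, o', f, h₂⟩ := runs_runM none false false (M.init x) hV hT P R (u ++ v)
    (N + p N * d) (p x.length) hm (by rw [hb]; rfl)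
  rw [hb] at h₂
  have h₃ := runs_drain (V := V) r o' f (M.halted b) (loaded V []) (work (u ++ v)) .c₁ []
    (by simp) (by simp)
  have h₄ := runs_drain (V := V) none o' f (M.halted b) (loaded V [])
    (pour .c₁ [] (work (u ++ v))) .c₂ [] (by simp) (by simp)
  have e₄ : pour .c₂ [] (pour .c₁ [] (work (u ++ v))) = fun _ => [] := by
    funext j
    cases j <;> simp [pour, work]
  have l₃ : (work (u ++ v) .c₁).length = u.length + v.length := by simp [work]
  have l₄ : (pour .c₁ [] (work (u ++ v)) .c₂).length = u.length + v.length := by simp [pour, work]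
  rw [l₃] at h₃
  rw [e₄, l₄] at h₄
  refine ((h₁.seq (h₂.seq (h₃.seq (h₄.seq (Runs.block rfl))))).mono ?_).of_eq rfl
  have h₅ : p x.length * (answerTime T P R (u ++ v).length (N + p N * d) + 4) ≤
      p N * (answerTime T P R N (N + p N * d) + 4) :=
    Nat.mul_le_mul (hp (by omega)) (Nat.add_le_add_right
      (answerTime_mono_left P R _ (by simp; omega)) _)
  simp only [simTime]
  omega

/-! #### Polynomial bounds -/

/-- The function `f` is given by a polynomial. -/
def IsPoly (f : ℕ → ℕ) : Prop := ∃ P : Polynomial ℕ, ∀ n, f n = P.eval n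

theorem IsPoly.const (a : ℕ) : IsPoly fun _ => a := ⟨Polynomial.C a, by simp⟩

theorem IsPoly.id : IsPoly fun n => n := ⟨Polynomial.X, by simp⟩

theorem IsPoly.add {f g : ℕ → ℕ} (hf : IsPoly f) (hg : IsPoly g) : IsPoly fun n => f n + g n :=
  let ⟨P, hP⟩ := hf
  let ⟨Q, hQ⟩ := hg
  ⟨P + Q, by simp [hP, hQ]⟩

theorem IsPoly.mul {f g : ℕ → ℕ} (hf : IsPoly f) (hg : IsPoly g) : IsPoly fun n => f n * g n :=
  let ⟨P, hP⟩ := hf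
  let ⟨Q, hQ⟩ := hg
  ⟨P * Q, by simp [hP, hQ]⟩

theorem IsPoly.comp {f g : ℕ → ℕ} (hf : IsPoly f) (hg : IsPoly g) : IsPoly fun n => f (g n) :=
  let ⟨P, hP⟩ := hf
  let ⟨Q, hQ⟩ := hg
  ⟨P.comp Q, by simp [hP, hQ]⟩

theorem monotone_eval (P : Polynomial ℕ) : Monotone fun n => P.eval n := by
  intro m n h
  simp only [Polynomial.eval_eq_sum_range]
  gcongr

theorem isPoly_horner (L : List ℕ) : IsPoly (horner L) := by
  induction L with
  | nil => exact .const 0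
  | cons a L ih => exact (ih.mul .id).add (.const a)

theorem exists_horner_eq (P : Polynomial ℕ) : ∃ L, ∀ n, horner L n = P.eval n := by
  induction P using Polynomial.recOnHorner with
  | M0 => exact ⟨[], by simp⟩
  | MC P a _ _ ih =>
    obtain ⟨L, hL⟩ := ih
    cases L with
    | nil => exact ⟨[a], fun n => by simp [← hL]⟩
    | cons b L => exact ⟨(b + a) :: L, fun n => by simp [← hL, add_assoc]⟩
  | MX P _ ih =>
    obtain ⟨L, hL⟩ := ih
    exact ⟨0 :: L, by simp [hL]⟩

theorem isPoly_hornerTime (L : List ℕ) : IsPoly (hornerTime L) := by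
  induction L with
  | nil => exact .const 2
  | cons a L ih =>
    have h := isPoly_horner L
    exact ih.add ((((IsPoly.const 3).mul h).add (h.mul (((IsPoly.const 6).mul .id).add
      (.const 3)))).add (.const 4))

theorem isPoly_simTime {p : ℕ → ℕ} (hT : IsPoly T) (hp : IsPoly p) (P R : List ℕ) (d : ℕ) :
    IsPoly (simTime T p P R d) := by
  have hm : IsPoly fun N => N + p N * d := IsPoly.id.add (hp.mul (.const d))
  have h₁ := (isPoly_horner P).comp hm
  have h₂ := (isPoly_horner R).comp hm
  have h₃ := (isPoly_hornerTime P).comp hm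
  have h₄ := (isPoly_hornerTime R).comp hm
  have c := IsPoly.const
  have h₅ := hT.comp (((hm.add h₂).add h₁).add (c 2))
  have h₆ : IsPoly fun N => testTime T (horner P (N + p N * d)) (horner R (N + p N * d))
      (N + p N * d) :=
    (((((c 9).mul h₁).add ((c 9).mul h₂)).add ((c 6).mul hm)).add ((c 3).mul h₅)).add (c 15)
  have hL : IsPoly fun N => N + 1 := IsPoly.id.add (c 1)
  have h₇ : IsPoly fun N => answerTime T P R N (N + p N * d) :=
    (((((((c 9).mul hm).add ((c 3).mul h₁)).add ((c 3).mul h₂)).add h₃).add h₄).add (c 9)).add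
      (hL.mul ((hL.mul (h₆.add (c 6))).add (c 10)))
  exact ((hp.mul (h₇.add (c 4))).add ((c 12).mul .id)).add (c 10)

/-- A polynomial-time oracle machine, whose queries are answered according to the certificates, is
a polynomial-time verifier. -/
theorem polyTimeVerifier_of_oracleTM (hA : PolyTimeVerifier A) (p : Polynomial ℕ) (P R : List ℕ)
    (F : List Bool → List Bool → List Bool → Bool)
    (hF : ∀ x u v, M.OutputsWithin (fun _ => verdictOn A (horner P) (horner R) (u ++ v)) x
      (F x u v) (p.eval x.length)) : PolyTimeVerifier F := by
  obtain ⟨V⟩ := hA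
  have hV : Computes V.toTM2ComputableAux A fun n => V.time.eval n := by
    intro x u v
    obtain ⟨⟨t, h⟩, ht⟩ := V.outputsFun (x, u, v)
    refine ⟨t, ht.trans (monotone_eval _ ?_), h⟩
    simp [encodeTriple]
    omega
  obtain ⟨d, hd⟩ := exists_length_run_le M
  obtain ⟨Q, hQ⟩ := isPoly_simTime (T := fun n => V.time.eval n) (p := fun n => p.eval n)
    ⟨V.time, fun _ => rfl⟩ ⟨p, fun _ => rfl⟩ P R d
  have key : ∀ a : List Bool × List Bool × List Bool, ∃ t ≤ Q.eval (encodeTriple a).length,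
      (flip bind (simMachine M V.toTM2ComputableAux P R).step)^[t]
        (some (initList (simMachine M V.toTM2ComputableAux P R) (encodeTriple a))) =
      some (haltList (simMachine M V.toTM2ComputableAux P R)
        [M.outputAlphabet.symm (F a.1 a.2.1 a.2.2)]) := by
    rintro ⟨x, u, v⟩
    obtain ⟨t, ht, h⟩ := exists_runs_simProg hV (monotone_eval _) (monotone_eval p) P R hd x u v
      (F x u v) (hF x u v)
    refine ⟨t, (ht.trans (hQ _).le).trans (monotone_eval _ ?_), ?_⟩
    · simp [encodeTriple]
      omega
    · rw [initList_simMachine, haltList_simMachine P R (F x u v) _ (fun k => ?_) (fun k => ?_)]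
      · exact h.stepsTo_halt
      · rfl
      · rcases k with k | k
        · exact initList_nil_stk _ k
        · rfl
  choose t ht h using key
  exact ⟨{
    tm := simMachine M V.toTM2ComputableAux P R
    inputAlphabet := Equiv.refl (Option Bool)
    outputAlphabet := M.outputAlphabet
    time := Q
    outputsFun := fun a => ⟨⟨t a, by
      have e : (encodeTriple a).map (Equiv.refl (Option Bool)).invFun = encodeTriple a :=
        List.map_id _
      exact (congrArg _ (congrArg some (congrArg _ e))).trans (h a)⟩, ht a⟩ }⟩

end Simulation

/-! ### Irrefutable certificates -/

/-- If each element of a set of fewer than `2 ^ k` elements is accepted by less than half of all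
random strings, then some `k` strings contain a rejecting one for each element. -/
theorem exists_hitting_list {X R : Type*} [Fintype R] (acc : X → R → Bool) (k : ℕ) (S : Finset X)
    (hS : ∀ x ∈ S, 2 * (Finset.univ.filter fun r => acc x r = true).card < Fintype.card R)
    (hk : S.card < 2 ^ k) :
    ∃ l : List R, l.length ≤ k ∧ ∀ x ∈ S, ∃ r ∈ l, acc x r = false := by
  induction k generalizing S with
  | zero => exact ⟨[], le_rfl, by simp_all⟩
  | succ k ih =>
    rcases S.eq_empty_or_nonempty with rfl | hne
    · exact ⟨[], by simp, by simp⟩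
    -- Double counting of the accepted pairs: if every `r` were accepted by at least half of `S`,
    -- some element of `S` would accept at least half of all `r`. The elements not rejected by `r`
    -- number fewer than `2 ^ k` and go to the induction hypothesis.
    obtain ⟨r, hr⟩ : ∃ r, 2 * (S.filter fun x => acc x r = true).card < S.card := by
      by_contra! h
      have h₁ : ∑ x ∈ S, (Finset.univ.filter fun r => acc x r = true).card =
          ∑ r, (S.filter fun x => acc x r = true).card := by
        simp only [Finset.card_filter]
        exact Finset.sum_comm
      have h₂ : ∑ x ∈ S, 2 * (Finset.univ.filter fun r => acc x r = true).card <
          ∑ _x ∈ S, Fintype.card R := Finset.sum_lt_sum_of_nonempty hne hS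
      have h₃ : ∑ _r : R, S.card ≤ ∑ r, 2 * (S.filter fun x => acc x r = true).card :=
        Finset.sum_le_sum fun r _ => h r
      rw [← Finset.mul_sum, h₁, Finset.mul_sum] at h₂
      simp only [Finset.sum_const, smul_eq_mul, Finset.card_univ] at h₂ h₃
      rw [mul_comm] at h₃
      omega
    obtain ⟨l, hl, h⟩ := ih (S.filter fun x => acc x r = true)
      (fun x hx => hS x (Finset.mem_filter.1 hx).1) (by rw [pow_succ] at hk; omega)
    refine ⟨r :: l, by simpa using hl, fun x hx => ?_⟩
    cases hx' : acc x r with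
    | false => exact ⟨r, by simp, hx'⟩
    | true =>
      obtain ⟨r', hr', h'⟩ := h x (Finset.mem_filter.2 ⟨hx, hx'⟩)
      exact ⟨r', by simp [hr'], h'⟩

theorem exists_ofFn_eq {α : Type*} {n : ℕ} {l : List α} (h : l.length = n) :
    ∃ f : Fin n → α, List.ofFn f = l := by
  subst h
  exact ⟨l.get, List.ofFn_get l⟩

theorem two_mul_card_lt_of_uniformProb_lt {t : ℕ} (E : List Bool → Bool)
    (h : uniformProb t (fun r => E r = true) < 1 / 2) :
    2 * (Finset.univ.filter fun r : Fin t → Bool => E (List.ofFn r) = true).card <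
      Fintype.card (Fin t → Bool) := by
  rw [uniformProb, Nat.card_eq_fintype_card, Fintype.card_subtype,
    div_lt_div_iff₀ (by positivity) two_pos] at h
  rw [Fintype.card_fun, Fintype.card_bool, Fintype.card_fin]
  have : ((2 * (Finset.univ.filter fun r : Fin t → Bool => E (List.ofFn r) = true).card : ℕ) : ℚ) <
      ((2 ^ t : ℕ) : ℚ) := by
    push_cast
    linarith
  exact_mod_cast this

/-- Polynomially many random strings refute all witnesses for all instances of a given length. -/
theorem exists_refuting_list (A : List Bool → List Bool → List Bool → Bool) (no : List Bool → Prop)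
    (m p t : ℕ)
    (h : ∀ x, no x → x.length = m → ∀ w : List Bool, w.length = p →
      uniformProb t (fun r => A x r w = true) < 1 / 2) :
    ∃ l : List (List Bool), l.length ≤ m + p + 1 ∧ (∀ r ∈ l, r.length = t) ∧
      ∀ x, no x → x.length = m → ∀ w : List Bool, w.length = p → ∃ r ∈ l, A x r w = false := by
  classical
  -- The objects to be refuted are pairs of an instance and a witness. There are at most `2 ^ (m +
  -- p)` of them, and the strict bound required costs one more string.
  let S : Finset ((Fin m → Bool) × (Fin p → Bool)) :=
    Finset.univ.filter fun y => no (List.ofFn y.1)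
  have hS : S.card < 2 ^ (m + p + 1) := by
    refine (Finset.card_le_univ S).trans_lt ?_
    simp only [Fintype.card_prod, Fintype.card_fun, Fintype.card_bool, Fintype.card_fin]
    rw [← pow_add]
    exact Nat.pow_lt_pow_right one_lt_two (Nat.lt_succ_self _)
  obtain ⟨l, hl, hlS⟩ := exists_hitting_list (R := Fin t → Bool)
    (fun (y : (Fin m → Bool) × (Fin p → Bool)) r =>
      A (List.ofFn y.1) (List.ofFn r) (List.ofFn y.2)) (m + p + 1) S
    (fun y hy => two_mul_card_lt_of_uniformProb_lt
      (fun r => A (List.ofFn y.1) r (List.ofFn y.2))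
      (h _ (Finset.mem_filter.1 hy).2 (by simp) _ (by simp))) hS
  refine ⟨l.map List.ofFn, by simpa using hl, by simp, ?_⟩
  intro x hx hxm w hw
  obtain ⟨x, rfl⟩ := exists_ofFn_eq hxm
  obtain ⟨w, rfl⟩ := exists_ofFn_eq hw
  obtain ⟨r, hr, h'⟩ := hlS (x, w) (Finset.mem_filter.2 ⟨Finset.mem_univ _, hx⟩)
  exact ⟨List.ofFn r, List.mem_map_of_mem hr, h'⟩

/-! ### Correct answers from a string containing the good certificate -/

namespace Simulation

/-- The suffix that begins where `y` occurs is long enough, so its window is `y` itself, without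
padding. -/
theorem exists_win_eq_of_infix {y c : List Bool} (h : y <:+: c) :
    ∃ z ∈ c.tails, win y.length z = y := by
  obtain ⟨a, b, rfl⟩ := h
  refine ⟨y ++ b, ?_, by simp [win]⟩
  rw [List.mem_tails, List.append_assoc]
  exact List.suffix_append _ _

/-- Certificates which contain a good witness and refuting random strings give correct answers. -/
theorem verdictOn_correct {A : List Bool → List Bool → List Bool → Bool} {P : PromiseProblem}
    {p t : ℕ → ℕ} {c q w : List Bool} {l : List (List Bool)} (hw : w.length = p q.length)
    (hl : ∀ r ∈ l, r.length = t q.length) (hwc : w <:+: c) (hlc : ∀ r ∈ l, r <:+: c)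
    (hyes : q ∈ P.yes → ∀ r : List Bool, r.length = t q.length → A q r w = true)
    (hno : q ∈ P.no → ∀ w : List Bool, w.length = p q.length → ∃ r ∈ l, A q r w = false) :
    (q ∈ P.yes → verdictOn A p t c q = true) ∧ (q ∈ P.no → verdictOn A p t c q = false) := by
  constructor
  · intro hq
    obtain ⟨z, hz, e⟩ := exists_win_eq_of_infix hwc
    rw [hw] at e
    simp only [verdictOn, List.any_eq_true, List.all_eq_true]
    -- Thanks to the padding every window has the length of a random string, so perfect completeness
    -- applies to all of them, wherever they come from.
    exact ⟨z, hz, fun z₂ _ => by rw [e]; exact hyes hq _ (length_win _ _)⟩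
  · intro hq
    simp only [verdictOn, List.any_eq_false, List.all_eq_true, not_forall]
    intro z _
    -- Any window, adversarial or padded, is a witness of the right length, hence rejected by some
    -- string of `l`, which is itself a window of `c`.
    obtain ⟨r, hr, h⟩ := hno hq (win (p q.length) z) (length_win _ _)
    obtain ⟨z₂, hz₂, e⟩ := exists_win_eq_of_infix (hlc r hr)
    rw [hl r hr] at e
    exact ⟨z₂, hz₂, by rw [e, h]; simp⟩

theorem length_flatten_le {α : Type*} {l : List (List α)} {b : ℕ} (h : ∀ x ∈ l, x.length ≤ b) :
    l.flatten.length ≤ l.length * b := by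
  induction l with
  | nil => simp
  | cons x l ih =>
    have h₁ := h x (by simp)
    have h₂ := ih fun y hy => h y (by simp [hy])
    simp only [List.flatten_cons, List.length_append, List.length_cons, add_mul]
    omega

theorem infix_flatten {α : Type*} {l : List (List α)} {x : List α} (h : x ∈ l) :
    x <:+: l.flatten := by
  obtain ⟨a, b, rfl⟩ := List.append_of_mem h
  exact ⟨a.flatten, b.flatten, by simp⟩

/-- One string contains good witnesses and refuting random strings for all lengths up to `Q`. -/
theorem exists_certificate {w : ℕ → List Bool} {l : ℕ → List (List Bool)} {p t : ℕ → ℕ}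
    (hp : Monotone p) (ht : Monotone t) (hw : ∀ m, (w m).length = p m)
    (hl : ∀ m, (l m).length ≤ m + p m + 1) (hlt : ∀ m, ∀ r ∈ l m, r.length = t m) (Q : ℕ) :
    ∃ c : List Bool, c.length = (Q + 1) * (p Q + (Q + p Q + 1) * t Q) ∧
      ∀ m ≤ Q, w m <:+: c ∧ ∀ r ∈ l m, r <:+: c := by
  let f : ℕ → List Bool := fun m => w m ++ (l m).flatten
  let c := ((List.range (Q + 1)).map f).flatten
  have hc : c.length ≤ (Q + 1) * (p Q + (Q + p Q + 1) * t Q) := by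
    refine (length_flatten_le (b := p Q + (Q + p Q + 1) * t Q) ?_).trans (by simp)
    intro y hy
    obtain ⟨m, hm, rfl⟩ := List.mem_map.1 hy
    have hmQ : m ≤ Q := by
      have := List.mem_range.1 hm
      omega
    rw [List.length_append, hw]
    refine add_le_add (hp hmQ) ((length_flatten_le fun r hr => (hlt m r hr).le).trans ?_)
    have h₁ := hp hmQ
    exact Nat.mul_le_mul ((hl m).trans (by omega)) (ht hmQ)
  -- Certificates need an exact length. Zeros at the end are harmless, since only occurrence as an
  -- infix matters.
  refine ⟨c ++ List.replicate ((Q + 1) * (p Q + (Q + p Q + 1) * t Q) - c.length) false,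
    by simp; omega, fun m hm => ?_⟩
  have hf : f m <:+: c ++ List.replicate
      ((Q + 1) * (p Q + (Q + p Q + 1) * t Q) - c.length) false :=
    (infix_flatten (List.mem_map_of_mem (List.mem_range.2 (Nat.lt_succ_of_le hm)))).trans
      (List.prefix_append _ _).isInfix
  exact ⟨(List.prefix_append _ _).isInfix.trans hf, fun r hr =>
    ((infix_flatten hr).trans (List.suffix_append _ _).isInfix).trans hf⟩

variable {M : OracleTM}

/-- A run depends on the oracle only through the words met along it. This permits changing the
answers to long queries, which never occur. -/
theorem run_congr (a a' : List Bool → Bool) (mc : M.Cfg) (k : ℕ)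
    (h : ∀ i < k, a (M.queryWord (M.run (fun _ => a) mc i)) =
      a' (M.queryWord (M.run (fun _ => a) mc i))) :
    M.run (fun _ => a) mc k = M.run (fun _ => a') mc k := by
  induction k with
  | zero => rfl
  | succ k ih =>
    rw [OracleTM.run, OracleTM.run, ← ih fun i hi => h i (by omega)]
    simp only [OracleTM.step, h k (by omega)]

theorem halted_injective : Function.Injective M.halted := by
  intro b b' h
  have := congrArg (fun c : M.Cfg => c.stk M.tm.k₁) h
  simp only [OracleTM.halted, haltList_stk_self, encodeBool] at this
  simpa using this

end Simulation

/-! ### The inclusion of the classes -/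

open Simulation

theorem mainTheorem7 : PWithOracleClass PrOMA ⊆ O2P := by
  classical
  rintro L ⟨P, ⟨p, t, A, hA, h⟩, M, pM, htot, hcorrect⟩
  choose w hw hwx using h
  have hl := fun m => exists_refuting_list A (· ∈ P.no) m (p.eval m) (t.eval m)
    fun x hx hxm => (hwx m x hxm).2 hx
  choose l hl hlt hlno using hl
  obtain ⟨Lp, hLp⟩ := exists_horner_eq p
  obtain ⟨Lt, hLt⟩ := exists_horner_eq t
  obtain ⟨d, hd⟩ := exists_length_run_le M
  -- The machine halts in time whatever the oracle answers, so the verdict is defined for all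
  -- certificates, including those that give wrong answers.
  choose F hF using fun x u v : List Bool =>
    htot x fun _ => verdictOn A (horner Lp) (horner Lt) (u ++ v)
  -- This bounds the query length: the input, plus at most `d` symbols in each of `pM.eval n` steps.
  have hQ : IsPoly fun n => n + pM.eval n * d :=
    IsPoly.id.add (.mul ⟨pM, fun _ => rfl⟩ (.const d))
  have hp : IsPoly fun n => p.eval n := ⟨p, fun _ => rfl⟩
  have ht : IsPoly fun n => t.eval n := ⟨t, fun _ => rfl⟩
  obtain ⟨s, hs⟩ : IsPoly fun n => (n + pM.eval n * d + 1) * (p.eval (n + pM.eval n * d) +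
      (n + pM.eval n * d + p.eval (n + pM.eval n * d) + 1) * t.eval (n + pM.eval n * d)) :=
    (hQ.add (.const 1)).mul ((hp.comp hQ).add
      (((hQ.add (hp.comp hQ)).add (.const 1)).mul (ht.comp hQ)))
  refine ⟨s, F, polyTimeVerifier_of_oracleTM hA pM Lp Lt F hF, fun n => ?_⟩
  obtain ⟨c, hc, hcert⟩ := exists_certificate (monotone_eval p) (monotone_eval t) hw hl hlt
    (n + pM.eval n * d)
  -- The condition does not say which side `c` comes from, so this one equivalence serves both the
  -- yes-side and the no-side.
  have key : ∀ x u v : List Bool, x.length = n → c <:+: u ++ v → (F x u v = true ↔ x ∈ L) := by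
    intro x u v hx hcuv
    let a := verdictOn A (horner Lp) (horner Lt) (u ++ v)
    -- The certificate guarantees correct answers only for queries up to the bound, while
    -- `LooselyAnswers` concerns all lengths. Longer queries are answered by membership in `P.yes`;
    -- the run never reaches them.
    let a' : List Bool → Bool := fun q =>
      if q.length ≤ n + pM.eval n * d then a q else decide (q ∈ P.yes)
    have hloose : LooselyAnswers (fun _ => a') P := by
      intro _ q
      by_cases hq : q.length ≤ n + pM.eval n * d
      · simp only [a', if_pos hq]
        obtain ⟨hwc, hlc⟩ := hcert q.length hq
        exact verdictOn_correct ((hw _).trans (hLp _).symm)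
          (fun r hr => (hlt _ r hr).trans (hLt _).symm) (hwc.trans hcuv)
          (fun r hr => (hlc r hr).trans hcuv)
          (fun hq r hr => (hwx _ q rfl).1 hq r (hr.trans (hLt _)))
          (fun hq w hw => hlno _ q hq rfl w (hw.trans (hLp _)))
      · simp only [a', if_neg hq]
        exact ⟨fun h => by simpa using h, fun h => by simpa using fun h' => P.disjoint q h' h⟩
    obtain ⟨b, hb, hbL⟩ := hcorrect x (fun _ => a') hloose
    have hrun : M.run (fun _ => a) (M.init x) (pM.eval x.length) =
        M.run (fun _ => a') (M.init x) (pM.eval x.length) := by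
      refine run_congr a a' _ _ fun i hi => ?_
      have hlen : (M.queryWord (M.run (fun _ => a) (M.init x) i)).length ≤ n + pM.eval n * d := by
        rw [OracleTM.queryWord, List.length_map]
        refine (hd _ _ _ _).trans (add_le_add ((length_init_le x _).trans hx.le) ?_)
        rw [hx] at hi
        exact Nat.mul_le_mul_right _ hi.le
      simp only [a', if_pos hlen]
    have : F x u v = b := halted_injective ((hF x u v).symm.trans (hrun.trans hb))
    rw [this, hbL]
  -- The same string is the irrefutable certificate for both sides.
  refine ⟨c, c, hc.trans (hs n), hc.trans (hs n), fun x hx => ⟨fun hxL v _ => ?_, fun hxL u _ => ?_⟩⟩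
  · exact (key x c v hx (List.prefix_append _ _).isInfix).2 hxL
  · have := (key x u c hx (List.suffix_append _ _).isInfix).not.2 hxL
    simpa using this

end
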